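/- Let $W=C_0([0,1])$ be the space of continuous functions $w:[0,1]\to\mathbb R$ with $w(0)=0$, with the sup norm and its Borel $\sigma$-algebra, let $\mu$ be the Wiener measure on $W$, and let $H$ be the Cameron–Martin space, i.e. the real Hilbert space of all $h(t)=\int_0^t h'(s)\,ds$ with $h'\in L^2([0,1])$ and $(h,k)_H=\int_0^1 h'(s)k'(s)\,ds$. For $h\in H$ let $\delta h=\int_0^1 h'(s)\,dw(s)\in L^2(\mu)$ be its Wiener integral. Let $R$ be a unitary (i.e. surjective linear isometric) operator on $H$, extended complex-linearly to the complexification $H_{\mathbb C}$, and let $(\Pi_\theta)_{\theta\in[0,2\pi]}$ be its resolution of the identity: an increasing, strongly right continuous family of orthogonal projections of $H_{\mathbb C}$ with $\Pi_0=0$, $\Pi_{2\pi}=I$ and $R=\int_0^{2\pi}e^{i\theta}\,d\Pi_\theta$, i.e. $(Rz,z)=\int_{(0,2\pi]}e^{i\theta}\,d(\Pi_\theta z,z)$ for all $z\in H_{\mathbb C}$. Let $(e_i)_{i\in\mathbb N}$ be a complete orthonormal basis of $H$. Then there is a measurable map $T:W\to W$ with $$Tw=\sum_{i}\delta(Re_i)(w)\,e_i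 ,$$ the series converging uniformly on $[0,1]$ for $\mu$-almost every $w$, and every such $T$ preserves $\mu$. Moreover, $T$ is ergodic if and only if $\theta\mapsto(\Pi_\theta h,k)$ is continuous on $[0,2\pi]$ for all $h,k\in H$; and if $T$ is ergodic, then it is weak mixing, i.e. $\frac1n\sum_{k=0}^{n-1}\left|\mu(T^{-k}A\cap B)-\mu(A)\mu(B)\right|\to0$ as $n\to\infty$ for all Borel sets $A,B\subseteq W$. -/

import Mathlib

open MeasureTheory ProbabilityTheory Filter Topology Set

noncomputable section

namespace WienerRotation

/-! ### The classical Wiener space `(C₀([0,1]), H, μ)` -/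

/-- The continuous functions on `[0,1]` which vanish at `0`. -/
def pathSubmodule : Submodule ℝ C(unitInterval, ℝ) where
  carrier := {w | w 0 = 0}
  add_mem' := by
    intro a b ha hb
    have ha' : a 0 = 0 := ha
    have hb' : b 0 = 0 := hb
    simp [ha', hb']
  zero_mem' := by simp
  smul_mem' := by
    intro c a ha
    have ha' : a 0 = 0 := ha
    simp [ha']

/-- The path space `C₀([0,1])`, a Banach space with the sup norm. -/
abbrev WienerSpace : Type := ↥pathSubmodule

/-- The Borel σ-algebra of the sup norm. -/
instance : MeasurableSpace WienerSpace := borel WienerSpace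

instance : BorelSpace WienerSpace := ⟨rfl⟩

/-- The value `w_t` of the path `w` at time `t`. -/
def coord (t : unitInterval) (w : WienerSpace) : ℝ := w.1 t

/-- `μ` is the Wiener measure on `C₀([0,1])`: under `μ` the coordinate process `(w_t)` is a
centered Gaussian process with covariance `E[w_s w_t] = min s t`. -/
structure IsWienerMeasure (μ : Measure WienerSpace) : Prop where
  isGaussianProcess : IsGaussianProcess coord μ
  integral_coord : ∀ t, ∫ w, coord t w ∂μ = 0
  covariance_coord : ∀ s t : unitInterval,
    ∫ w, coord s w * coord t w ∂μ = min (s : ℝ) (t : ℝ)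

lemma IsWienerMeasure.memLp_coord {μ : Measure WienerSpace} (hμ : IsWienerMeasure μ)
    (t : unitInterval) : MemLp (coord t) 2 μ :=
  (hμ.isGaussianProcess.hasGaussianLaw_eval t).memLp_two

/-- The space `L²([0,1])` with respect to the Lebesgue measure. -/
abbrev L2I : Type := Lp ℝ 2 (volume : Measure unitInterval)

lemma integrable_L2I (f : L2I) : Integrable f :=
  (Lp.memLp f).integrable (by norm_num)

lemma continuous_primitive (f : L2I) :
    Continuous fun t : unitInterval => ∫ s in Set.Iic t, f s := by
  have h : (fun t : unitInterval => ∫ s in Set.Iic t, f s)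
      = fun t => ∫ s, (Set.Iic t).indicator f s := by
    funext t
    rw [integral_indicator measurableSet_Iic]
  rw [h, continuous_iff_continuousAt]
  intro t₀
  refine continuousAt_of_dominated (bound := fun s => ‖f s‖) ?_ ?_ (integrable_L2I f).norm ?_
  · exact Eventually.of_forall fun t =>
      (integrable_L2I f).aestronglyMeasurable.indicator measurableSet_Iic
  · exact Eventually.of_forall fun t => Eventually.of_forall fun s => norm_indicator_le_norm_self _ _
  · have hne : ∀ᵐ s : unitInterval, s ≠ t₀ := by
      simp [ae_iff]
    filter_upwards [hne] with s hs
    rcases lt_or_gt_of_ne hs with hlt | hgt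
    · refine (continuousAt_const (y := f s)).congr ?_
      filter_upwards [lt_mem_nhds hlt] with t ht
      rw [Set.indicator_of_mem (show s ∈ Set.Iic t from ht.le)]
    · refine (continuousAt_const (y := (0 : ℝ))).congr ?_
      filter_upwards [gt_mem_nhds hgt] with t ht
      rw [Set.indicator_of_notMem (by simpa using ht)]

/-- The primitive `t ↦ ∫_0^t f(s) ds` of `f ∈ L²([0,1])`, as an element of `C₀([0,1])`. -/
def primitive : L2I →ₗ[ℝ] WienerSpace where
  toFun f := ⟨⟨fun t => ∫ s in Set.Iic t, f s, continuous_primitive f⟩, by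
    have h : (Set.Iic (0 : unitInterval)) = {0} := by
      ext x
      simp only [Set.mem_Iic, Set.mem_singleton_iff]
      exact ⟨fun hx => le_antisymm hx x.2.1, fun hx => hx.le⟩
    change ∫ s in Set.Iic (0 : unitInterval), f s = 0
    rw [h]
    simp [Measure.restrict_singleton]⟩
  map_add' f g := by
    ext t
    change ∫ s in Set.Iic t, (f + g : L2I) s = (∫ s in Set.Iic t, f s) + ∫ s in Set.Iic t, g s
    rw [← integral_add (integrable_L2I f).integrableOn (integrable_L2I g).integrableOn]
    exact integral_congr_ae (ae_restrict_of_ae (Lp.coeFn_add f g))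
  map_smul' c f := by
    ext t
    change ∫ s in Set.Iic t, (c • f : L2I) s = c * ∫ s in Set.Iic t, f s
    rw [← integral_const_mul]
    exact integral_congr_ae (ae_restrict_of_ae (Lp.coeFn_smul c f))

lemma primitive_injective : Function.Injective primitive := by
  rw [injective_iff_map_eq_zero]
  intro f hf
  have h0 : ∀ t : unitInterval, ∫ s in Set.Iic t, f s = 0 := fun t =>
    congrArg (fun w : WienerSpace => w.1 t) hf
  have hint := integrable_L2I f
  have huniv : ∫ s, f s = 0 := by
    have h1 := h0 1
    have : (Set.Iic (1 : unitInterval)) = Set.univ := by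
      ext x
      simp only [Set.mem_Iic, Set.mem_univ, iff_true]
      exact Subtype.coe_le_coe.1 x.2.2
    rwa [this, Measure.restrict_univ] at h1
  have key : ∀ A : Set unitInterval, MeasurableSet A → ∫ s in A, f s = 0 := by
    intro A hA
    induction A, hA using MeasurableSpace.induction_on_inter
      (borel_eq_generateFrom_Iic unitInterval ▸ BorelSpace.measurable_eq) isPiSystem_Iic with
    | empty => simp
    | basic t ht =>
      obtain ⟨x, rfl⟩ := ht
      exact h0 x
    | compl t ht ih =>
      have := integral_add_compl ht hint
      rw [ih, huniv] at this
      linarith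
    | iUnion g hd hm ih =>
      rw [integral_iUnion hm hd hint.integrableOn]
      simp [ih]
  refine (Lp.eq_zero_iff_ae_eq_zero).2 ?_
  exact hint.ae_eq_zero_of_forall_setIntegral_eq_zero fun s hs _ => key s hs

/-- The Cameron–Martin space `H`: all `h ∈ C₀([0,1])` of the form `h(t) = ∫_0^t h'(s) ds` with
`h' ∈ L²([0,1])`, i.e. the absolutely continuous functions with square integrable derivative. -/
def CameronMartin : Type := ↥(LinearMap.range primitive)

namespace CameronMartin

instance : AddCommGroup CameronMartin := inferInstanceAs (AddCommGroup ↥(LinearMap.range primitive))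

instance : Module ℝ CameronMartin := inferInstanceAs (Module ℝ ↥(LinearMap.range primitive))

/-- The inclusion `H ⊆ C₀([0,1])`. -/
def toPath : CameronMartin →ₗ[ℝ] WienerSpace := (LinearMap.range primitive).subtype

/-- The bijection `h' ↦ h` from `L²([0,1])` to `H`. -/
def ofDeriv : L2I ≃ₗ[ℝ] CameronMartin := LinearEquiv.ofInjective primitive primitive_injective

/-- The derivative `h' ∈ L²([0,1])` of `h ∈ H`. -/
def deriv : CameronMartin ≃ₗ[ℝ] L2I := ofDeriv.symm

/-- The norm `|h|_H = |h'|_{L²}`. -/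
instance : NormedAddCommGroup CameronMartin :=
  NormedAddCommGroup.induced CameronMartin L2I deriv.toLinearMap deriv.injective

/-- The inner product `(h, k)_H = ∫_0^1 h'(s) k'(s) ds`. -/
instance : InnerProductSpace ℝ CameronMartin where
  inner h k := inner ℝ (deriv h) (deriv k)
  norm_smul_le c h := by
    change ‖deriv (c • h)‖ ≤ ‖c‖ * ‖deriv h‖
    rw [map_smul]
    exact norm_smul_le c (deriv h)
  norm_sq_eq_re_inner h := norm_sq_eq_re_inner (𝕜 := ℝ) (deriv h)
  conj_inner_symm h k := inner_conj_symm (𝕜 := ℝ) (deriv h) (deriv k)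
  add_left h k l := by
    rw [map_add]
    exact inner_add_left _ _ _
  smul_left h k c := by
    rw [map_smul]
    exact inner_smul_left _ _ _

/-- The element `s ↦ min s t` of `H`, whose derivative is the indicator of `[0,t]`. -/
def evalRep (t : unitInterval) : CameronMartin :=
  ofDeriv (indicatorConstLp 2 (measurableSet_Iic (a := t)) (measure_ne_top _ _) (1 : ℝ))

lemma inner_evalRep (s t : unitInterval) :
    inner ℝ (evalRep s) (evalRep t) = min (s : ℝ) (t : ℝ) := by
  change inner ℝ (CameronMartin.deriv (ofDeriv _)) (CameronMartin.deriv (ofDeriv _)) = _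
  simp only [CameronMartin.deriv, LinearEquiv.symm_apply_apply]
  rw [L2.real_inner_indicatorConstLp_one_indicatorConstLp_one measurableSet_Iic measurableSet_Iic,
    Set.Iic_inter_Iic, measureReal_def, unitInterval.volume_Iic,
    ENNReal.toReal_ofReal (s ⊓ t).2.1]
  exact (Subtype.mono_coe _).map_inf s t

lemma inner_evalRep_left (t : unitInterval) (h : CameronMartin) :
    inner ℝ (evalRep t) h = coord t (toPath h) := by
  obtain ⟨f, rfl⟩ := ofDeriv.surjective h
  change inner ℝ (CameronMartin.deriv (ofDeriv _)) (CameronMartin.deriv (ofDeriv _)) = _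
  simp only [CameronMartin.deriv, LinearEquiv.symm_apply_apply]
  rw [L2.inner_indicatorConstLp_one]
  rfl

/-- `H` is a Hilbert space. -/
instance : CompleteSpace CameronMartin := by
  let E : CameronMartin ≃ₗᵢ[ℝ] L2I := ⟨CameronMartin.deriv, fun _ => rfl⟩
  exact (completeSpace_congr (e := E.toIsometryEquiv.toEquiv) E.isometry.isUniformEmbedding).2
    (inferInstanceAs (CompleteSpace L2I))

lemma denseRange_evalRep : DenseRange (Finsupp.linearCombination ℝ evalRep) := by
  have h : (LinearMap.range (Finsupp.linearCombination ℝ evalRep)).topologicalClosure = ⊤ := by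
    rw [Submodule.topologicalClosure_eq_top_iff, Submodule.eq_bot_iff]
    intro h hh
    rw [Submodule.mem_orthogonal] at hh
    have h0 : ∀ t, coord t (toPath h) = 0 := fun t => by
      rw [← inner_evalRep_left]
      exact hh _ ⟨Finsupp.single t 1, by simp⟩
    have h1 : toPath h = toPath 0 := by
      rw [map_zero]
      ext t
      exact h0 t
    exact Subtype.val_injective h1
  rw [← Submodule.dense_iff_topologicalClosure_eq_top] at h
  exact h

end CameronMartin

/-- The Wiener integral `δh = ∫_0^1 h'(s) dw(s) ∈ L²(μ)`: the continuous extension to `H` of the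
linear map which sends the element with derivative `1_{[0,t]}` to `w_t`. -/
def wienerIntegral {μ : Measure WienerSpace} (hμ : IsWienerMeasure μ) :
    CameronMartin →L[ℝ] Lp ℝ 2 μ :=
  (Finsupp.linearCombination ℝ fun t => (hμ.memLp_coord t).toLp (coord t)).extendOfNorm
    (Finsupp.linearCombination ℝ CameronMartin.evalRep)

lemma norm_linearCombination_coord {μ : Measure WienerSpace} (hμ : IsWienerMeasure μ)
    (c : unitInterval →₀ ℝ) :
    ‖Finsupp.linearCombination ℝ (fun t => (hμ.memLp_coord t).toLp (coord t)) c‖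
      = ‖Finsupp.linearCombination ℝ CameronMartin.evalRep c‖ := by
  rw [← sq_eq_sq₀ (norm_nonneg _) (norm_nonneg _), ← real_inner_self_eq_norm_sq,
    ← real_inner_self_eq_norm_sq]
  simp only [Finsupp.linearCombination_apply, Finsupp.sum, sum_inner, inner_sum,
    real_inner_smul_left, real_inner_smul_right, CameronMartin.inner_evalRep]
  refine Finset.sum_congr rfl fun i _ => Finset.sum_congr rfl fun j _ => ?_
  congr 2
  rw [L2.inner_def, ← hμ.covariance_coord]
  refine integral_congr_ae ?_
  filter_upwards [(hμ.memLp_coord i).coeFn_toLp, (hμ.memLp_coord j).coeFn_toLp] with w h1 h2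
  simp [h1, h2, mul_comm]

/-- The extension defining the Wiener integral is a genuine one: the integral of `1_{[0,t]}` is
`w_t`. -/
lemma wienerIntegral_evalRep {μ : Measure WienerSpace} (hμ : IsWienerMeasure μ)
    (t : unitInterval) :
    wienerIntegral hμ (CameronMartin.evalRep t) = (hμ.memLp_coord t).toLp (coord t) := by
  have h := LinearMap.extendOfNorm_eq
    (f := Finsupp.linearCombination ℝ fun t => (hμ.memLp_coord t).toLp (coord t))
    CameronMartin.denseRange_evalRep
    ⟨1, fun c => by rw [one_mul, norm_linearCombination_coord hμ]⟩ (Finsupp.single t 1)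
  simpa [wienerIntegral] using h

/-- `T` is (a version of) the rotation `Tw = ∑ᵢ δ(R eᵢ)(w) eᵢ`, the series converging uniformly
on `[0,1]` for almost every `w`. -/
structure IsRotation {μ : Measure WienerSpace} (hμ : IsWienerMeasure μ)
    (R : CameronMartin ≃ₗᵢ[ℝ] CameronMartin) (e : HilbertBasis ℕ ℝ CameronMartin)
    (T : WienerSpace → WienerSpace) : Prop where
  measurable : Measurable T
  tendsto : ∀ᵐ w ∂μ, Tendsto
    (fun n : ℕ => ∑ i ∈ Finset.range n, (wienerIntegral hμ (R (e i)) : WienerSpace → ℝ) w •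
      CameronMartin.toPath (e i)) atTop (𝓝 (T w))

/-- `T` is weak mixing: it preserves `μ`, and
`(1/n) ∑_{k<n} |μ(T⁻ᵏA ∩ B) - μ(A) μ(B)| → 0` for all measurable `A`, `B`. -/
structure IsWeakMixing {Ω : Type*} [MeasurableSpace Ω] (T : Ω → Ω) (μ : Measure Ω) : Prop where
  measurePreserving : MeasurePreserving T μ μ
  tendsto : ∀ A B : Set Ω, MeasurableSet A → MeasurableSet B → Tendsto
    (fun n : ℕ => (n : ℝ)⁻¹ * ∑ k ∈ Finset.range n,
      |μ.real (T^[k] ⁻¹' A ∩ B) - μ.real A * μ.real B|) atTop (𝓝 0)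

/-! ### Complexification of a real inner product space -/

/-- The complexification `H + iH` of a real inner product space `H`. -/
@[ext]
structure Complexification (H : Type*) where
  re : H
  im : H

namespace Complexification

/-- The pairs of real and imaginary parts. -/
def equivProd {H : Type*} : Complexification H ≃ H × H where
  toFun z := (z.re, z.im)
  invFun p := ⟨p.1, p.2⟩

instance {H : Type*} [AddCommGroup H] : AddCommGroup (Complexification H) := equivProd.addCommGroup

lemma add_def {H : Type*} [AddCommGroup H] (z z' : Complexification H) : z + z' = ⟨z.re + z'.re, z.im + z'.im⟩ := rfl

lemma zero_def {H : Type*} [AddCommGroup H] : (0 : Complexification H) = ⟨0, 0⟩ := rfl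

variable {H : Type*} [NormedAddCommGroup H] [InnerProductSpace ℝ H]

instance : SMul ℂ (Complexification H) where
  smul c z := ⟨c.re • z.re - c.im • z.im, c.re • z.im + c.im • z.re⟩

lemma smul_def (c : ℂ) (z : Complexification H) :
    c • z = ⟨c.re • z.re - c.im • z.im, c.re • z.im + c.im • z.re⟩ := rfl

instance : Module ℂ (Complexification H) where
  one_smul z := by simp [smul_def]
  mul_smul a b z := by
    simp only [smul_def, Complex.mul_re, Complex.mul_im]
    ext <;> module
  smul_zero a := by simp [smul_def, zero_def]
  smul_add a z z' := by
    simp only [smul_def, add_def]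
    ext <;> module
  add_smul a b z := by
    simp only [smul_def, add_def, Complex.add_re, Complex.add_im]
    ext <;> module
  zero_smul z := by simp [smul_def, zero_def]

/-- The sesquilinear extension of the inner product, conjugate linear in the first variable. -/
@[reducible]
def innerCore : InnerProductSpace.Core ℂ (Complexification H) where
  inner z z' := ⟨inner ℝ z.re z'.re + inner ℝ z.im z'.im,
    inner ℝ z.re z'.im - inner ℝ z.im z'.re⟩
  conj_inner_symm z z' := by
    apply Complex.ext
    · simp [real_inner_comm]
    · simp only [Complex.conj_im]
      rw [real_inner_comm z'.re z.im, real_inner_comm z.re z'.im]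
      ring
  re_inner_nonneg z := by
    change 0 ≤ inner ℝ z.re z.re + inner ℝ z.im z.im
    exact add_nonneg real_inner_self_nonneg real_inner_self_nonneg
  add_left z z' u := by
    apply Complex.ext <;> simp only [add_def, inner_add_left, Complex.add_re, Complex.add_im] <;> ring
  smul_left z u c := by
    apply Complex.ext <;>
      simp only [smul_def, inner_add_left, inner_sub_left, real_inner_smul_left, Complex.mul_re,
        Complex.mul_im, Complex.conj_re, Complex.conj_im] <;> ring
  definite z hz := by
    have h : inner ℝ z.re z.re + inner ℝ z.im z.im = 0 := congrArg Complex.re hz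
    have h1 : 0 ≤ inner ℝ z.re z.re := real_inner_self_nonneg
    have h2 : 0 ≤ inner ℝ z.im z.im := real_inner_self_nonneg
    have h3 : z.re = 0 := inner_self_eq_zero.1 (le_antisymm (by linarith) h1)
    have h4 : z.im = 0 := inner_self_eq_zero.1 (le_antisymm (by linarith) h2)
    exact Complexification.ext h3 h4

instance : NormedAddCommGroup (Complexification H) := innerCore.toNormedAddCommGroup

instance : InnerProductSpace ℂ (Complexification H) := InnerProductSpace.ofCore innerCore.toCore

/-- The inclusion `H ⊆ H + iH`. -/
def ofReal (h : H) : Complexification H := ⟨h, 0⟩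

/-- The complex linear extension `R(x + iy) = Rx + iRy` of a real linear map. -/
def mapLinear (R : H →ₗ[ℝ] H) : Complexification H →ₗ[ℂ] Complexification H where
  toFun z := ⟨R z.re, R z.im⟩
  map_add' z z' := by simp [add_def]
  map_smul' c z := by simp [smul_def]

end Complexification

/-! ### Resolutions of the identity on `[0, 2π]` -/

section Spectral

variable {K : Type*} [NormedAddCommGroup K] [InnerProductSpace ℂ K]

/-- A resolution of the identity `(Π_θ)` on `[0, 2π]`: an increasing, strongly right continuous
family of orthogonal projections with `Π_0 = 0` and `Π_{2π} = 1`; it is extended to all real `θ` by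
`0` to the left and by `1` to the right. -/
structure IsResolutionOfIdentity (P : ℝ → K →L[ℂ] K) : Prop where
  isSymmetricProjection : ∀ θ, (P θ).toLinearMap.IsSymmetricProjection
  mul_of_le : ∀ s t, s ≤ t → P s * P t = P s
  right_continuous : ∀ z θ, ContinuousWithinAt (fun s => P s z) (Set.Ici θ) θ
  eq_zero : ∀ θ, θ ≤ 0 → P θ = 0
  eq_one : ∀ θ, 2 * Real.pi ≤ θ → P θ = 1

lemma IsResolutionOfIdentity.inner_self {P : ℝ → K →L[ℂ] K} (hP : IsResolutionOfIdentity P)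
    (θ : ℝ) (z : K) : (inner ℂ (P θ z) z).re = ‖P θ z‖ ^ 2 := by
  have h1 : P θ (P θ z) = P θ z :=
    LinearMap.congr_fun (hP.isSymmetricProjection θ).isIdempotentElem z
  have h2 : inner ℂ (P θ (P θ z)) z = inner ℂ (P θ z) (P θ z) :=
    (hP.isSymmetricProjection θ).isSymmetric (P θ z) z
  rw [h1] at h2
  rw [h2]
  exact (norm_sq_eq_re_inner (𝕜 := ℂ) (P θ z)).symm

lemma IsResolutionOfIdentity.norm_le {P : ℝ → K →L[ℂ] K} (hP : IsResolutionOfIdentity P)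
    (θ : ℝ) (z : K) : ‖P θ z‖ ≤ ‖z‖ := by
  by_contra hlt
  push Not at hlt
  have h1 := hP.inner_self θ z
  have h2 : (inner ℂ (P θ z) z).re ≤ ‖P θ z‖ * ‖z‖ :=
    (Complex.re_le_norm _).trans (norm_inner_le_norm _ _)
  nlinarith [norm_nonneg z, norm_nonneg (P θ z)]

/-- The right continuous increasing function `θ ↦ (Π_θ z, z)`. -/
def IsResolutionOfIdentity.stieltjes {P : ℝ → K →L[ℂ] K} (hP : IsResolutionOfIdentity P)
    (z : K) : StieltjesFunction ℝ where
  toFun θ := (inner ℂ (P θ z) z).re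
  mono' := by
    intro s t hst
    simp only [hP.inner_self]
    have h : P s z = P s (P t z) := by
      conv_lhs => rw [← hP.mul_of_le s t hst]
      rfl
    rw [h]
    exact pow_le_pow_left₀ (norm_nonneg _) (hP.norm_le s (P t z)) 2
  right_continuous' := by
    intro θ
    have h : Continuous fun y : K => (inner ℂ y z).re := by fun_prop
    exact h.continuousAt.comp_continuousWithinAt (hP.right_continuous z θ)

/-- `(Π_θ)` is the resolution of the identity of the operator `U`: `U = ∫ e^{iθ} dΠ_θ`, that is
`(Uz, z) = ∫ e^{iθ} d(Π_θ z, z)` for every `z`. The inner product of Mathlib is linear in its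
second variable, so `(Uz, z)` is written `inner ℂ z (U z)`. -/
structure IsSpectralResolution (U : K →ₗ[ℂ] K) (P : ℝ → K →L[ℂ] K) : Prop where
  isResolution : IsResolutionOfIdentity P
  integral_eq : ∀ z, inner ℂ z (U z) =
    ∫ θ : ℝ, Complex.exp (Complex.I * θ) ∂(isResolution.stieltjes z).measure

end Spectral

end WienerRotation

end

/-!
Write `δ` for the Wiener integral and `(·,·)` for the inner product of `H`. Everything about the
rotation `T` follows from the identity `w_t ∘ T = δ(R (min t ·))`, valid almost surely for each
`t`; a measurable map of the path space with this property, for a linear isometry `V` in place of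
`R`, is called a transport (`IsTransport`). As the Wiener integrals are jointly Gaussian with the
covariances of `H`, the law of a family of them only depends on its Gram matrix
(`map_eq_map_of_norm_linearCombination_eq`). Hence a transport preserves `μ`, and by density
`δh ∘ T = δ(Vh)` for all `h` (`IsTransport.wienerIntegral_comp`).

*Existence and convergence.* Along a dense sequence of times the process `δ(V (min t ·))` has the
law of the coordinate process, so it is almost surely the restriction of a continuous path, which
gives a transport `X` (`exists_isTransport`). That the partial sums `S_n = ∑_{i<n} δ(V eᵢ) eᵢ`
converge to `X` uniformly is a special case of the Itô–Nisio theorem. It is obtained here from a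
reflection argument: the reflection of `H` fixing `e₀, …, e_{n-1}` and changing the sign of the
other `eᵢ` shows that `X` and `2 S_n - X` have the same law given the first `n` coefficients. Since
`S_n` is their midpoint, the indicator of `‖S_n - x‖ > ε` is at most twice the conditional
probability of `‖X - x‖ > ε` given these coefficients, and the latter tends to the indicator of
`‖X - x‖ > ε` by Lévy's upward theorem. Letting `x` run over a countable dense set proves the
convergence (`IsTransport.tendsto_partialSum`). As the limit of the series is almost surely unique,
every version of the rotation is a transport for `R` (`IsRotation.isTransport`).

*Continuity implies weak mixing.* The exponentials `exp (i δh)` are total in `L²(μ; ℂ)`, and the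
correlation of `exp (i δh)` with `exp (i δk) ∘ Tⁿ` is controlled by `(Rⁿ k, h)`; so `T` is weak
mixing as soon as the Cesàro means of `|(Rⁿ k, h)|` tend to zero (`IsTransport.isWeakMixing`). By
polarization it is enough to consider `(Rⁿ z, z)`, which is the `n`-th Fourier coefficient of the
measure `d(Π_θ z, z)` (`IsSpectralResolution.inner_pow_apply`). If `(Π_θ)` is continuous, this
measure has no atoms and Wiener's lemma applies (`isNullInMean_fourier`).

*Ergodicity implies continuity.* A jump `Π_θ z - Π_{θ-} z` is an eigenvector of `R` for the
eigenvalue `e^{iθ}` (`IsSpectralResolution.continuous_apply`). If `h + ik` is an eigenvector for a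
unimodular eigenvalue, then `(δh)² + (δk)²` is a `T`-invariant function, and it is not constant
because `δh` and `δk` are Gaussian (`IsTransport.eq_zero_of_mapLinear_eq_smul`).
-/


noncomputable section

namespace WienerRotation

/-! ### Gaussian laws of Wiener integrals -/

/-- A finite Borel measure on a Polish vector space is determined by the integrals of `exp (i ℓ)`,
`ℓ` running over the linear combinations of a separating family of continuous functionals. -/
lemma measure_ext_of_integral_exp {V ι : Type*} [AddCommGroup V] [Module ℝ V] [TopologicalSpace V]
    [PolishSpace V] [MeasurableSpace V] [BorelSpace V] (l : ι → V →ₗ[ℝ] ℝ)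
    (hl : ∀ i, Continuous (l i)) (hsep : ∀ v, (∀ i, l i v = 0) → v = 0)
    {P Q : Measure V} [IsFiniteMeasure P] [IsFiniteMeasure Q]
    (h : ∀ c : ι →₀ ℝ, ∫ v, Complex.exp ((c.sum fun i a => a * l i v : ℝ) * Complex.I) ∂P
      = ∫ v, Complex.exp ((c.sum fun i a => a * l i v : ℝ) * Complex.I) ∂Q) : P = Q := by
  let := TopologicalSpace.upgradeIsCompletelyMetrizable V
  let : TopologicalSpace (ι →₀ ℝ) := ⊥
  have : DiscreteTopology (ι →₀ ℝ) := ⟨rfl⟩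
  let L : V →ₗ[ℝ] (ι →₀ ℝ) →ₗ[ℝ] ℝ :=
    (Finsupp.lsum ℝ fun i => LinearMap.toSpanSingleton ℝ (V →ₗ[ℝ] ℝ) (l i)).flip
  have hLv : ∀ v c, L v c = c.sum fun i a => a * l i v := by
    intro v c
    simp [L, Finsupp.sum, LinearMap.sum_apply]
  refine ext_of_integral_char_eq (e := Real.probChar) (L := L) Real.continuous_probChar
    Real.probChar_ne_one ?_ ?_ fun c => ?_
  · intro v hv h0
    refine hv (hsep v fun i => ?_)
    have := hLv v (Finsupp.single i 1)
    rw [h0] at this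
    simpa using this.symm
  · rw [continuous_prod_of_discrete_right]
    intro c
    simp only [hLv, Finsupp.sum]
    exact continuous_finsetSum _ fun i _ => continuous_const.mul (hl i)
  · have := h c
    simp only [← hLv] at this
    exact this

lemma continuous_coord (t : unitInterval) : Continuous (coord t) :=
  (continuous_eval_const t).comp continuous_subtype_val

instance : CompleteSpace WienerSpace := by
  have h : IsClosed (pathSubmodule : Set C(unitInterval, ℝ)) :=
    isClosed_eq (continuous_eval_const (0 : unitInterval)) continuous_const
  exact h.completeSpace_coe

/-- The value at time `t`, as a linear functional on the path space. -/
def coordLinear (t : unitInterval) : WienerSpace →ₗ[ℝ] ℝ where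
  toFun := coord t
  map_add' _ _ := rfl
  map_smul' _ _ := rfl

lemma IsWienerMeasure.isProbabilityMeasure {μ : Measure WienerSpace} (hμ : IsWienerMeasure μ) :
    IsProbabilityMeasure μ := hμ.isGaussianProcess.isProbabilityMeasure

section WienerIntegral

variable {μ : Measure WienerSpace} (hμ : IsWienerMeasure μ)

lemma ae_eq_wienerIntegral_linearCombination {ι : Type*} {f : ι → WienerSpace → ℝ}
    {h : ι → CameronMartin} (hf : ∀ i, f i =ᵐ[μ] wienerIntegral hμ (h i)) (c : ι →₀ ℝ) :
    (fun w => c.sum fun i a => a * f i w)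
      =ᵐ[μ] wienerIntegral hμ (Finsupp.linearCombination ℝ h c) := by
  have h1 : wienerIntegral hμ (Finsupp.linearCombination ℝ h c)
      = ∑ i ∈ c.support, c i • wienerIntegral hμ (h i) := by
    rw [Finsupp.linearCombination_apply, Finsupp.sum, map_sum]
    simp only [map_smul]
  rw [h1]
  have h2 : ∀ᵐ w ∂μ, ∀ i ∈ c.support,
      (c i • wienerIntegral hμ (h i) : Lp ℝ 2 μ) w = c i * f i w := by
    refine (ae_ball_iff c.support.countable_toSet).2 ?_
    intro i _
    filter_upwards [hf i, Lp.coeFn_smul (c i) (wienerIntegral hμ (h i))] with w h1 h2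
    rw [h2, Pi.smul_apply, h1, smul_eq_mul]
  filter_upwards [h2, Lp.coeFn_finsetSum c.support
    (fun i => c i • wienerIntegral hμ (h i))] with w h3 h4
  rw [h4, Finset.sum_apply]
  exact Finset.sum_congr rfl fun i hi => (h3 i hi).symm

lemma coord_ae_eq_wienerIntegral (t : unitInterval) :
    coord t =ᵐ[μ] wienerIntegral hμ (CameronMartin.evalRep t) := by
  rw [wienerIntegral_evalRep]
  exact (hμ.memLp_coord t).coeFn_toLp.symm

lemma norm_wienerIntegral (h : CameronMartin) : ‖wienerIntegral hμ h‖ = ‖h‖ := by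
  induction h using isClosed_property CameronMartin.denseRange_evalRep with
  | hp => exact isClosed_eq (wienerIntegral hμ).continuous.norm continuous_norm
  | h c =>
    have h1 : wienerIntegral hμ (Finsupp.linearCombination ℝ CameronMartin.evalRep c)
        = Finsupp.linearCombination ℝ (fun t => (hμ.memLp_coord t).toLp (coord t)) c := by
      rw [Finsupp.linearCombination_apply, Finsupp.linearCombination_apply, Finsupp.sum, map_sum]
      simp only [map_smul, wienerIntegral_evalRep, Finsupp.sum]
    rw [h1, norm_linearCombination_coord hμ]

/-- The characteristic function at `1` depends continuously on `f ∈ L²`, as `|e^{ia} - e^{ib}|` is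
at most `|a - b|`. -/
lemma continuous_integral_exp_Lp {Ω : Type*} [MeasurableSpace Ω] {μ : Measure Ω}
    [IsProbabilityMeasure μ] :
    Continuous fun f : Lp ℝ 2 μ => ∫ w, Complex.exp (f w * Complex.I) ∂μ := by
  have hint : ∀ f : Lp ℝ 2 μ, Integrable (fun w => Complex.exp (f w * Complex.I)) μ := by
    intro f
    refine Integrable.of_bound (C := 1) ?_ ?_
    · exact (Continuous.comp_aestronglyMeasurable (g := fun x : ℝ => Complex.exp (x * Complex.I))
        (by fun_prop) (Lp.aestronglyMeasurable f))
    · exact Eventually.of_forall fun w => (Complex.norm_exp_ofReal_mul_I _).le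
  have hL1 : ∀ f : Lp ℝ 2 μ, ∫ w, ‖f w‖ ∂μ ≤ ‖f‖ := by
    intro f
    have h1 : eLpNorm f 1 μ ≤ eLpNorm f 2 μ :=
      eLpNorm_le_eLpNorm_of_exponent_le (by norm_num) (Lp.aestronglyMeasurable f)
    rw [integral_norm_eq_lintegral_enorm (Lp.aestronglyMeasurable f), Lp.norm_def,
      ← eLpNorm_one_eq_lintegral_enorm]
    exact ENNReal.toReal_mono (Lp.eLpNorm_ne_top f) h1
  refine LipschitzWith.continuous (K := 1) (LipschitzWith.of_dist_le_mul fun f g => ?_)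
  rw [NNReal.coe_one, one_mul, dist_eq_norm, dist_eq_norm, ← integral_sub (hint f) (hint g)]
  refine (norm_integral_le_integral_norm _).trans (le_trans ?_ (hL1 (f - g)))
  refine integral_mono_ae ((hint f).sub (hint g)).norm
    ((Lp.memLp (f - g)).integrable (by norm_num)).norm ?_
  filter_upwards [Lp.coeFn_sub f g] with w hw
  have h2 : Complex.exp (f w * Complex.I) - Complex.exp (g w * Complex.I)
      = Complex.exp (g w * Complex.I) *
        (Complex.exp (Complex.I * ((f - g : Lp ℝ 2 μ) w : ℝ)) - 1) := by
    rw [hw, Pi.sub_apply, mul_sub, ← Complex.exp_add, mul_one]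
    congr 2
    push_cast
    ring
  change ‖_ - _‖ ≤ _
  rw [h2, norm_mul, Complex.norm_exp_ofReal_mul_I, one_mul]
  exact Real.norm_exp_I_mul_ofReal_sub_one_le

/-- The characteristic functional of the Wiener integral: for a combination of the `min t ·` it is
the characteristic function of a Gaussian combination of coordinates, and both sides are continuous
in `h`. -/
lemma integral_exp_wienerIntegral (h : CameronMartin) :
    ∫ w, Complex.exp (wienerIntegral hμ h w * Complex.I) ∂μ
      = Complex.exp ((-(‖h‖ ^ 2 / 2) : ℝ) : ℂ) := by
  have := hμ.isProbabilityMeasure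
  induction h using isClosed_property CameronMartin.denseRange_evalRep with
  | hp =>
    refine isClosed_eq (continuous_integral_exp_Lp.comp (wienerIntegral hμ).continuous) ?_
    fun_prop
  | h c =>
    set Y : WienerSpace → ℝ := fun w => c.sum fun t a => a * coord t w with hY
    have hae := (ae_eq_wienerIntegral_linearCombination hμ (coord_ae_eq_wienerIntegral hμ) c).symm
    have hgauss : HasGaussianLaw Y μ :=
      (hμ.isGaussianProcess.smul c).hasGaussianLaw_fun_sum (I := c.support)
    have hmean : μ[Y] = 0 := by
      simp only [hY, Finsupp.sum]
      rw [integral_finsetSum _ fun t _ =>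
        ((hμ.memLp_coord t).integrable (by norm_num)).const_mul _]
      simp [integral_const_mul, hμ.integral_coord]
    have hvar : Var[Y; μ] = ‖Finsupp.linearCombination ℝ CameronMartin.evalRep c‖ ^ 2 := by
      rw [variance_of_integral_eq_zero hgauss.aemeasurable hmean, ← norm_wienerIntegral hμ,
        ← real_inner_self_eq_norm_sq, L2.inner_def]
      refine integral_congr_ae ?_
      filter_upwards [hae] with w hw
      simp [hw, hY, sq]
    have h1 : ∫ w, Complex.exp (Y w * Complex.I) ∂μ = charFun (μ.map Y) 1 := by
      rw [charFun_apply_real, integral_map hgauss.aemeasurable (by fun_prop)]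
      simp
    rw [integral_congr_ae (g := fun w => Complex.exp (Y w * Complex.I))
      (by filter_upwards [hae] with w hw; rw [hw]), h1, hgauss.map_eq_gaussianReal,
      charFun_gaussianReal, hmean, Real.coe_toNNReal _ (variance_nonneg _ _), hvar]
    push_cast
    ring_nf

/-- The Wiener integral `δh` is a centered Gaussian variable with variance `‖h‖²`. -/
lemma map_wienerIntegral (h : CameronMartin) :
    μ.map (wienerIntegral hμ h) = gaussianReal 0 (‖h‖ ^ 2).toNNReal := by
  have := hμ.isProbabilityMeasure
  have hm : AEMeasurable (wienerIntegral hμ h) μ := (Lp.aestronglyMeasurable _).aemeasurable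
  have := Measure.isProbabilityMeasure_map hm
  refine Measure.ext_of_charFun ?_
  ext t
  rw [charFun_apply_real, integral_map hm (by fun_prop), charFun_gaussianReal,
    Real.coe_toNNReal _ (sq_nonneg _)]
  have h1 := integral_exp_wienerIntegral hμ (t • h)
  rw [map_smul, norm_smul] at h1
  refine Eq.trans (integral_congr_ae ?_) (h1.trans ?_)
  · filter_upwards [Lp.coeFn_smul t (wienerIntegral hμ h)] with w hw
    simp [hw]
  · rw [mul_pow, Real.norm_eq_abs, sq_abs]
    push_cast
    congr 1
    simp
    ring

/-- Two random vectors whose coordinates are Wiener integrals have the same law as soon as the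
Gram matrices of the integrands agree. The latter is expressed by the norms of linear
combinations. -/
lemma map_eq_map_of_norm_linearCombination_eq {V ι : Type*} [AddCommGroup V] [Module ℝ V]
    [TopologicalSpace V] [PolishSpace V] [MeasurableSpace V] [BorelSpace V]
    (l : ι → V →ₗ[ℝ] ℝ) (hl : ∀ i, Continuous (l i)) (hsep : ∀ v, (∀ i, l i v = 0) → v = 0)
    {F G : WienerSpace → V} (hFm : AEMeasurable F μ) (hGm : AEMeasurable G μ)
    {h k : ι → CameronMartin} (hF : ∀ i, (fun w => l i (F w)) =ᵐ[μ] wienerIntegral hμ (h i))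
    (hG : ∀ i, (fun w => l i (G w)) =ᵐ[μ] wienerIntegral hμ (k i))
    (hn : ∀ c, ‖Finsupp.linearCombination ℝ h c‖ = ‖Finsupp.linearCombination ℝ k c‖) :
    μ.map F = μ.map G := by
  have := hμ.isProbabilityMeasure
  have := Measure.isProbabilityMeasure_map hFm
  have := Measure.isProbabilityMeasure_map hGm
  have key : ∀ {E : WienerSpace → V} {m : ι → CameronMartin} (_ : AEMeasurable E μ)
      (_ : ∀ i, (fun w => l i (E w)) =ᵐ[μ] wienerIntegral hμ (m i)) (c : ι →₀ ℝ),
      ∫ v, Complex.exp ((c.sum fun i a => a * l i v : ℝ) * Complex.I) ∂(μ.map E)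
        = Complex.exp ((-(‖Finsupp.linearCombination ℝ m c‖ ^ 2 / 2) : ℝ) : ℂ) := by
    intro E m hE hm c
    have hc : Continuous fun v : V =>
        Complex.exp ((c.sum fun i a => a * l i v : ℝ) * Complex.I) := by
      simp only [Finsupp.sum]
      fun_prop
    rw [integral_map hE hc.aestronglyMeasurable, ← integral_exp_wienerIntegral hμ]
    refine integral_congr_ae ?_
    filter_upwards [ae_eq_wienerIntegral_linearCombination hμ hm c] with w hw
    rw [← hw]
  refine measure_ext_of_integral_exp l hl hsep fun c => ?_
  rw [key hFm hF, key hGm hG, hn]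

end WienerIntegral

/-! ### Measurable maps inducing an isometry of `H` -/

/-- `X` is a measurable path-valued version of the process `t ↦ δ(V (min t ·))`. As `w_t` is
`δ(min t ·)`, this says that `X` implements `V` on the coordinates. -/
structure IsTransport {μ : Measure WienerSpace} (hμ : IsWienerMeasure μ)
    (V : CameronMartin →ₗᵢ[ℝ] CameronMartin) (X : WienerSpace → WienerSpace) : Prop where
  measurable : Measurable X
  coord_ae_eq : ∀ t, (fun w => coord t (X w))
    =ᵐ[μ] wienerIntegral hμ (V (CameronMartin.evalRep t))

instance : PolishSpace WienerSpace where

lemma coord_separates (w : WienerSpace) (h : ∀ t, coordLinear t w = 0) : w = 0 := by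
  ext t
  exact h t

lemma norm_linearCombination_comp {ι : Type*} (V : CameronMartin →ₗᵢ[ℝ] CameronMartin)
    (h : ι → CameronMartin) (c : ι →₀ ℝ) :
    ‖Finsupp.linearCombination ℝ (fun i => V (h i)) c‖ = ‖Finsupp.linearCombination ℝ h c‖ := by
  rw [← V.norm_map (Finsupp.linearCombination ℝ h c), Finsupp.linearCombination_apply,
    Finsupp.linearCombination_apply, Finsupp.sum, Finsupp.sum, map_sum]
  simp only [map_smul]

lemma continuous_evalRep : Continuous CameronMartin.evalRep := by
  refine continuous_iff_continuousAt.2 fun t => tendsto_iff_norm_sub_tendsto_zero.2 ?_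
  have h1 : ∀ s : unitInterval, ‖CameronMartin.evalRep s - CameronMartin.evalRep t‖
      = √((s : ℝ) - 2 * min (s : ℝ) t + t) := by
    intro s
    rw [← Real.sqrt_sq (norm_nonneg _), norm_sub_sq_real, ← real_inner_self_eq_norm_sq,
      ← real_inner_self_eq_norm_sq]
    simp only [CameronMartin.inner_evalRep, min_self]
  simp only [h1]
  have h2 : Continuous fun s : unitInterval => √((s : ℝ) - 2 * min (s : ℝ) t + t) := by fun_prop
  convert h2.tendsto t using 2
  simp only [min_self]
  rw [show (t : ℝ) - 2 * t + t = 0 by ring, Real.sqrt_zero]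

/-- A limit in `L²` and an almost sure limit of the same sequence agree. -/
lemma ae_eq_of_tendsto_Lp {Ω E : Type*} [MeasurableSpace Ω] [NormedAddCommGroup E]
    {μ : Measure Ω} {f : ℕ → Lp E 2 μ} {g : Lp E 2 μ} {F : ℕ → Ω → E} {G : Ω → E}
    (hfF : ∀ n, F n =ᵐ[μ] f n) (hf : Tendsto f atTop (𝓝 g))
    (hF : ∀ᵐ w ∂μ, Tendsto (fun n => F n w) atTop (𝓝 (G w))) : G =ᵐ[μ] g := by
  obtain ⟨ns, hns, hg⟩ := (tendstoInMeasure_of_tendsto_Lp hf).exists_seq_tendsto_ae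
  filter_upwards [hg, hF, ae_all_iff.2 hfF] with w h1 h2 h3
  refine tendsto_nhds_unique (h2.comp hns.tendsto_atTop) (h1.congr fun n => ?_)
  exact (h3 (ns n)).symm

/-- The restriction to a dense sequence of times identifies the path space with a measurable subset
of `ℝ^ℕ`, by the Lusin–Souslin theorem. -/
lemma measurableEmbedding_coord_denseSeq : MeasurableEmbedding fun (w : WienerSpace) (n : ℕ) =>
    coord (TopologicalSpace.denseSeq unitInterval n) w := by
  refine (continuous_pi fun n => continuous_coord _).measurableEmbedding fun w w' h => ?_
  have h1 : (w.1 : unitInterval → ℝ) = w'.1 :=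
    (TopologicalSpace.denseRange_denseSeq unitInterval).equalizer w.1.continuous w'.1.continuous
      (funext fun n => congrFun h n)
  exact Subtype.ext (DFunLike.coe_injective h1)

section

variable {μ : Measure WienerSpace} (hμ : IsWienerMeasure μ)
  (V : CameronMartin →ₗᵢ[ℝ] CameronMartin)

/-- Along a dense sequence of times, the process `δ(V (min t ·))` has the same law as the coordinate
process, hence is almost surely the restriction of a path. -/
lemma exists_isTransport : ∃ X, IsTransport hμ V X := by
  have := hμ.isProbabilityMeasure
  let d := TopologicalSpace.denseSeq unitInterval
  have hd : DenseRange d := TopologicalSpace.denseRange_denseSeq unitInterval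
  let r : WienerSpace → ℕ → ℝ := fun w n => coord (d n) w
  have hr : Continuous r := continuous_pi fun n => continuous_coord (d n)
  have hre : MeasurableEmbedding r := measurableEmbedding_coord_denseSeq
  let Y : WienerSpace → ℕ → ℝ := fun w n => wienerIntegral hμ (V (CameronMartin.evalRep (d n))) w
  have hY : Measurable Y :=
    measurable_pi_lambda _ fun n => (Lp.stronglyMeasurable _).measurable
  have hlaw : μ.map r = μ.map Y := by
    refine map_eq_map_of_norm_linearCombination_eq hμ
      (h := fun n => CameronMartin.evalRep (d n)) (k := fun n => V (CameronMartin.evalRep (d n)))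
      (fun n => LinearMap.proj n) (fun n => continuous_apply n) (fun v hv => funext hv)
      hr.aemeasurable hY.aemeasurable (fun n => coord_ae_eq_wienerIntegral hμ (d n))
      (fun n => EventuallyEq.rfl) fun c => (norm_linearCombination_comp V _ c).symm
  have hrange : ∀ᵐ w ∂μ, Y w ∈ range r := by
    have h1 : ∀ᵐ y ∂(μ.map r), y ∈ range r := by
      refine (ae_map_iff hr.aemeasurable (p := fun y => y ∈ range r) hre.measurableSet_range).2 ?_
      exact Eventually.of_forall fun w => mem_range_self w
    rw [hlaw] at h1
    exact ae_of_ae_map hY.aemeasurable h1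
  obtain ⟨g, hg, hgr⟩ := hre.exists_measurable_extend measurable_id fun _ => ⟨0⟩
  have hdense : ∀ᵐ w ∂μ, ∀ n, coord (d n) (g (Y w))
      = wienerIntegral hμ (V (CameronMartin.evalRep (d n))) w := by
    filter_upwards [hrange] with w ⟨v, hv⟩ n
    have h1 : g (Y w) = v := by
      rw [← hv]
      exact congrFun hgr v
    rw [h1]
    exact congrFun hv n
  refine ⟨fun w => g (Y w), hg.comp hY, fun t => ?_⟩
  -- A general time is a limit of times of the dense sequence: the left side converges pathwise, the
  -- right side in `L²`.
  obtain ⟨u, hu, hut⟩ := mem_closure_iff_seq_limit.1 (hd t)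
  choose m hm using hu
  obtain rfl : (fun n => d (m n)) = u := funext hm
  refine ae_eq_of_tendsto_Lp (f := fun n => wienerIntegral hμ (V (CameronMartin.evalRep (d (m n)))))
    (F := fun n w => coord (d (m n)) (g (Y w))) (fun n => ?_) ?_ ?_
  · filter_upwards [hdense] with w hw
    exact hw (m n)
  · exact (((wienerIntegral hμ).continuous.comp V.continuous).comp continuous_evalRep).tendsto t
      |>.comp hut
  · exact Eventually.of_forall fun w => ((g (Y w)).1.continuous.tendsto t).comp hut

variable {hμ V}

lemma IsTransport.map_eq {X : WienerSpace → WienerSpace} (hX : IsTransport hμ V X) :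
    μ.map X = μ := by
  have h := map_eq_map_of_norm_linearCombination_eq hμ (F := X) (G := id)
    (h := fun t => V (CameronMartin.evalRep t)) (k := CameronMartin.evalRep)
    coordLinear continuous_coord coord_separates hX.measurable.aemeasurable aemeasurable_id
    hX.coord_ae_eq (coord_ae_eq_wienerIntegral hμ) fun c => norm_linearCombination_comp V _ c
  rw [h, Measure.map_id]

lemma IsTransport.measurePreserving {X : WienerSpace → WienerSpace} (hX : IsTransport hμ V X) :
    MeasurePreserving X μ μ := ⟨hX.measurable, hX.map_eq⟩

/-- `δh ∘ X = δ(V h)`: both sides are continuous in `h` and agree for `h = min t ·`. -/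
lemma IsTransport.wienerIntegral_comp {X : WienerSpace → WienerSpace} (hX : IsTransport hμ V X)
    (h : CameronMartin) :
    (fun w => wienerIntegral hμ h (X w)) =ᵐ[μ] wienerIntegral hμ (V h) := by
  have hcomp : ∀ h, (fun w => wienerIntegral hμ h (X w))
      =ᵐ[μ] Lp.compMeasurePreserving X hX.measurePreserving (wienerIntegral hμ h) := fun h =>
    (Lp.coeFn_compMeasurePreserving _ hX.measurePreserving).symm
  suffices hs : Lp.compMeasurePreserving X hX.measurePreserving (wienerIntegral hμ h)
      = wienerIntegral hμ (V h) by
    rw [← hs]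
    exact hcomp h
  induction h using isClosed_property CameronMartin.denseRange_evalRep with
  | hp =>
    exact isClosed_eq ((Lp.isometry_compMeasurePreserving hX.measurePreserving).continuous.comp
      (wienerIntegral hμ).continuous) ((wienerIntegral hμ).continuous.comp V.continuous)
  | h c =>
    refine Lp.ext ((hcomp _).symm.trans ?_)
    have h1 := hX.measurePreserving.quasiMeasurePreserving.ae_eq_comp
      (ae_eq_wienerIntegral_linearCombination hμ (coord_ae_eq_wienerIntegral hμ) c)
    have h2 := ae_eq_wienerIntegral_linearCombination hμ hX.coord_ae_eq c
    have h3 : V (Finsupp.linearCombination ℝ CameronMartin.evalRep c)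
        = Finsupp.linearCombination ℝ (fun t => V (CameronMartin.evalRep t)) c := by
      rw [Finsupp.linearCombination_apply, Finsupp.linearCombination_apply, Finsupp.sum, map_sum]
      simp only [map_smul, Finsupp.sum]
    rw [h3]
    exact h1.symm.trans h2

end

/-! ### Partial sums and reflections -/

/-- The orthogonal reflection which fixes `e₀, …, e_{n-1}` and changes the sign of the other basis
vectors. -/
def basisReflection {H : Type*} [NormedAddCommGroup H] [InnerProductSpace ℝ H]
    (e : HilbertBasis ℕ ℝ H) (n : ℕ) : H →ₗᵢ[ℝ] H where
  toLinearMap := (2 : ℝ) • (∑ i ∈ Finset.range n, (innerₗ H (e i)).smulRight (e i)) - LinearMap.id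
  norm_map' h := by
    have h1 : inner ℝ (∑ i ∈ Finset.range n, inner ℝ (e i) h • e i) h
        = ∑ i ∈ Finset.range n, (inner ℝ (e i) h : ℝ) ^ 2 := by
      simp only [sum_inner, real_inner_smul_left, sq]
    have h2 : ‖∑ i ∈ Finset.range n, inner ℝ (e i) h • e i‖ ^ 2
        = ∑ i ∈ Finset.range n, (inner ℝ (e i) h : ℝ) ^ 2 := by
      rw [← real_inner_self_eq_norm_sq, e.orthonormal.inner_sum]
      simp [sq]
    rw [← sq_eq_sq₀ (norm_nonneg _) (norm_nonneg _)]
    simp only [LinearMap.sub_apply, LinearMap.smul_apply, LinearMap.sum_apply,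
      LinearMap.smulRight_apply, innerₗ_apply_apply, LinearMap.id_apply]
    rw [norm_sub_sq_real, norm_smul, mul_pow, h2, real_inner_smul_left, h1]
    norm_num
    ring

lemma basisReflection_apply {H : Type*} [NormedAddCommGroup H] [InnerProductSpace ℝ H]
    (e : HilbertBasis ℕ ℝ H) (n : ℕ) (h : H) : basisReflection e n h
      = (2 : ℝ) • (∑ i ∈ Finset.range n, (inner ℝ (e i) h : ℝ) • e i) - h := by
  change ((2 : ℝ) • (∑ i ∈ Finset.range n, (innerₗ H (e i)).smulRight (e i)) -
    LinearMap.id : H →ₗ[ℝ] H) h = _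
  simp only [LinearMap.sub_apply, LinearMap.smul_apply, LinearMap.sum_apply,
      LinearMap.smulRight_apply, innerₗ_apply_apply, LinearMap.id_apply]

lemma basisReflection_basis {H : Type*} [NormedAddCommGroup H] [InnerProductSpace ℝ H]
    (e : HilbertBasis ℕ ℝ H) {n i : ℕ} (hi : i < n) : basisReflection e n (e i) = e i := by
  rw [basisReflection_apply]
  have h : ∑ j ∈ Finset.range n, (inner ℝ (e j) (e i) : ℝ) • e j = e i := by
    rw [Finset.sum_eq_single i]
    · simp [e.orthonormal.1 i]
    · intro j _ hj
      rw [e.orthonormal.2 hj, zero_smul]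
    · intro h
      exact absurd (Finset.mem_range.2 hi) h
  rw [h, two_smul, add_sub_cancel_right]

section

variable {μ : Measure WienerSpace} (hμ : IsWienerMeasure μ)
  (V : CameronMartin →ₗᵢ[ℝ] CameronMartin) (e : HilbertBasis ℕ ℝ CameronMartin)

/-- The partial sums `∑_{i<n} δ(V eᵢ) eᵢ`. -/
def partialSum (n : ℕ) (w : WienerSpace) : WienerSpace :=
  ∑ i ∈ Finset.range n, (wienerIntegral hμ (V (e i)) : WienerSpace → ℝ) w •
      CameronMartin.toPath (e i)

/-- The random vector `(δ(V e₀), …, δ(V e_{n-1}))`. -/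
def coefficients (n : ℕ) (w : WienerSpace) (i : Fin n) : ℝ := wienerIntegral hμ (V (e i)) w

/-- The path `∑_{i<n} yᵢ eᵢ`. -/
def synthesis {n : ℕ} (y : Fin n → ℝ) : WienerSpace := ∑ i, y i • CameronMartin.toPath (e i)

lemma partialSum_eq (n : ℕ) (w : WienerSpace) :
    partialSum hμ V e n w = synthesis e (coefficients hμ V e n w) := by
  rw [partialSum, Finset.sum_range]
  rfl

lemma measurable_synthesis (n : ℕ) : Measurable (synthesis e : (Fin n → ℝ) → WienerSpace) := by
  have : Continuous (synthesis e : (Fin n → ℝ) → WienerSpace) := by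
    unfold synthesis
    fun_prop
  exact this.measurable

lemma measurable_coefficients (n : ℕ) : Measurable (coefficients hμ V e n) :=
  measurable_pi_lambda _ fun _ => (Lp.stronglyMeasurable _).measurable

lemma measurable_partialSum (n : ℕ) : Measurable (partialSum hμ V e n) := by
  rw [show partialSum hμ V e n = synthesis e ∘ coefficients hμ V e n from
    funext (partialSum_eq hμ V e n)]
  exact (measurable_synthesis e n).comp (measurable_coefficients hμ V e n)

lemma coord_partialSum (n : ℕ) (t : unitInterval) (w : WienerSpace) :
    coord t (partialSum hμ V e n w) = ∑ i ∈ Finset.range n,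
      inner ℝ (e i) (CameronMartin.evalRep t) * wienerIntegral hμ (V (e i)) w := by
  change coordLinear t _ = _
  rw [partialSum, map_sum]
  refine Finset.sum_congr rfl fun i _ => ?_
  rw [map_smul, real_inner_comm, CameronMartin.inner_evalRep_left, smul_eq_mul, mul_comm]
  rfl

/-- The filtration of the σ-algebras generated by `δ(V e₀), …, δ(V e_{n-1})`. -/
def coefficientFiltration : Filtration ℕ (borel WienerSpace) where
  seq n := MeasurableSpace.comap (coefficients hμ V e n) inferInstance
  mono' m n hmn := by
    rintro _ ⟨B, hB, rfl⟩
    refine ⟨(fun (y : Fin n → ℝ) (i : Fin m) => y (Fin.castLE hmn i)) ⁻¹' B, ?_, rfl⟩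
    exact hB.preimage (measurable_pi_lambda _ fun i => measurable_pi_apply _)
  le' n := (measurable_coefficients hμ V e n).comap_le

variable {hμ V} {X : WienerSpace → WienerSpace}

/-- The remainder `X - S_n` is symmetric given the first `n` coefficients: replacing `V` by its
composition with the reflection replaces `X = S_n + (X - S_n)` by `S_n - (X - S_n)` and leaves the
first `n` coefficients and all covariances unchanged. -/
lemma IsTransport.map_coefficients_reflect (hX : IsTransport hμ V X) (n : ℕ) :
    μ.map (fun w => (coefficients hμ V e n w, X w))
      = μ.map (fun w => (coefficients hμ V e n w, (2 : ℝ) • partialSum hμ V e n w - X w)) := by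
  have hc := measurable_coefficients hμ V e n
  have hm : Measurable fun w => (2 : ℝ) • partialSum hμ V e n w - X w :=
    ((measurable_partialSum hμ V e n).const_smul (2 : ℝ)).sub hX.measurable
  let m : Fin n ⊕ unitInterval → CameronMartin := Sum.elim (fun i => e i) CameronMartin.evalRep
  refine map_eq_map_of_norm_linearCombination_eq hμ
    (l := Sum.elim (fun i => (LinearMap.proj i).comp (LinearMap.fst ℝ (Fin n → ℝ) WienerSpace))
      fun t => (coordLinear t).comp (LinearMap.snd ℝ (Fin n → ℝ) WienerSpace))
    (h := fun i => V (m i)) (k := fun i => (V.comp (basisReflection e n)) (m i))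
    ?_ ?_ (hc.prodMk hX.measurable).aemeasurable (hc.prodMk hm).aemeasurable ?_ ?_ ?_
  · rintro (i | t)
    · exact (continuous_apply i).comp continuous_fst
    · exact (continuous_coord t).comp continuous_snd
  · rintro ⟨y, w⟩ h
    exact Prod.ext (funext fun i => h (Sum.inl i)) (coord_separates w fun t => h (Sum.inr t))
  · rintro (i | t)
    · exact EventuallyEq.rfl
    · exact hX.coord_ae_eq t
  · rintro (i | t)
    · refine Eventually.of_forall fun w => ?_
      change _ = wienerIntegral hμ (V (basisReflection e n (e i))) w
      rw [basisReflection_basis e i.2]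
      rfl
    · change _ =ᵐ[μ] wienerIntegral hμ (V (basisReflection e n (CameronMartin.evalRep t)))
      let c : ℕ →₀ ℝ := ∑ i ∈ Finset.range n,
        Finsupp.single i (inner ℝ (e i) (CameronMartin.evalRep t))
      have h1 : V (basisReflection e n (CameronMartin.evalRep t)) = (2 : ℝ) •
          Finsupp.linearCombination ℝ (fun i => V (e i)) c - V (CameronMartin.evalRep t) := by
        rw [basisReflection_apply]
        simp [c, map_sum]
      have h2 := ae_eq_wienerIntegral_linearCombination hμ
        (f := fun i => wienerIntegral hμ (V (e i))) (h := fun i => V (e i))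
        (fun i => EventuallyEq.rfl) c
      rw [h1, map_sub, map_smul]
      filter_upwards [h2, hX.coord_ae_eq t,
        Lp.coeFn_sub
          ((2 : ℝ) • wienerIntegral hμ (Finsupp.linearCombination ℝ (fun i => V (e i)) c))
          (wienerIntegral hμ (V (CameronMartin.evalRep t))),
        Lp.coeFn_smul (2 : ℝ)
          (wienerIntegral hμ (Finsupp.linearCombination ℝ (fun i => V (e i)) c))] with w h3 h4 h5 h6
      rw [h5, Pi.sub_apply, h6, Pi.smul_apply, ← h3, ← h4]
      change (2 : ℝ) * coord t (partialSum hμ V e n w) - coord t (X w) = _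
      rw [coord_partialSum]
      congr 2
      rw [← Finsupp.sum_finsetSum_index (fun i => zero_mul _) (fun i a b => add_mul a b _)]
      simp
  · intro c
    rw [norm_linearCombination_comp, norm_linearCombination_comp]

lemma norm_two_smul (w : WienerSpace) : ‖(2 : ℝ) • w‖ = 2 * ‖w‖ := by
  have h := norm_smul (2 : ℝ) (w : C(unitInterval, ℝ))
  rwa [Real.norm_eq_abs, abs_two] at h

lemma measurableSet_norm_sub_gt (x : WienerSpace) (ε : ℝ) :
    MeasurableSet {y : WienerSpace | ε < ‖y - x‖} :=
  (isOpen_lt continuous_const (by fun_prop)).measurableSet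

/-- If `S_n` is at distance more than `ε` from `x`, then so is one of the points `X` and
`2 S_n - X`, which have midpoint `S_n` and the same law jointly with the first `n` coefficients. -/
lemma IsTransport.measureReal_partialSum_le (hX : IsTransport hμ V X) (n : ℕ) (x : WienerSpace)
    (ε : ℝ) {A : Set WienerSpace} (hA : MeasurableSet[coefficientFiltration hμ V e n] A) :
    μ.real (A ∩ {w | ε < ‖partialSum hμ V e n w - x‖}) ≤ 2 * μ.real (A ∩ {w | ε < ‖X w - x‖}) := by
  have := hμ.isProbabilityMeasure
  obtain ⟨B, hB, rfl⟩ := hA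
  have hc := measurable_coefficients hμ V e n
  have hm : Measurable fun w => (2 : ℝ) • partialSum hμ V e n w - X w :=
    ((measurable_partialSum hμ V e n).const_smul (2 : ℝ)).sub hX.measurable
  -- The event concerning `S_n` is moved into the condition on the coefficients.
  let B' : Set (Fin n → ℝ) := B ∩ {y | ε < ‖synthesis e y - x‖}
  have hB' : MeasurableSet B' :=
    hB.inter ((measurable_synthesis e n) (measurableSet_norm_sub_gt x ε))
  have hlaw : μ.real (coefficients hμ V e n ⁻¹' B' ∩ {w | ε < ‖X w - x‖})
      = μ.real (coefficients hμ V e n ⁻¹' B' ∩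
        {w | ε < ‖(2 : ℝ) • partialSum hμ V e n w - X w - x‖}) := by
    have h1 := congrArg (fun m : Measure ((Fin n → ℝ) × WienerSpace) =>
      m.real (B' ×ˢ {y : WienerSpace | ε < ‖y - x‖})) (hX.map_coefficients_reflect e n)
    rwa [map_measureReal_apply (hc.prodMk hX.measurable) (hB'.prod (measurableSet_norm_sub_gt x ε)),
      map_measureReal_apply (hc.prodMk hm) (hB'.prod (measurableSet_norm_sub_gt x ε))] at h1
  have hsub : coefficients hμ V e n ⁻¹' B ∩ {w | ε < ‖partialSum hμ V e n w - x‖} ⊆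
      (coefficients hμ V e n ⁻¹' B' ∩ {w | ε < ‖X w - x‖}) ∪ (coefficients hμ V e n ⁻¹' B' ∩
        {w | ε < ‖(2 : ℝ) • partialSum hμ V e n w - X w - x‖}) := by
    rintro w ⟨hw, hw'⟩
    have hmem : w ∈ coefficients hμ V e n ⁻¹' B' := by
      refine ⟨hw, ?_⟩
      rw [mem_ofPred_eq, ← partialSum_eq]
      exact hw'
    by_cases h1 : ε < ‖X w - x‖
    · exact Or.inl ⟨hmem, h1⟩
    · refine Or.inr ⟨hmem, ?_⟩
      rw [mem_ofPred_eq] at hw' ⊢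
      have h2 : (2 : ℝ) • (partialSum hμ V e n w - x)
          = ((2 : ℝ) • partialSum hμ V e n w - X w - x) + (X w - x) := by module
      have h3 := norm_add_le ((2 : ℝ) • partialSum hμ V e n w - X w - x) (X w - x)
      rw [← h2, norm_two_smul] at h3
      linarith
  have hle : μ.real (coefficients hμ V e n ⁻¹' B' ∩ {w | ε < ‖X w - x‖})
      ≤ μ.real (coefficients hμ V e n ⁻¹' B ∩ {w | ε < ‖X w - x‖}) :=
    measureReal_mono (inter_subset_inter_left _ (preimage_mono inter_subset_left))
  have h1 := (measureReal_mono hsub).trans (measureReal_union_le (μ := μ) _ _)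
  linarith

end

/-! ### Almost sure uniform convergence of the partial sums -/

lemma dist_eq_norm_path (w v : WienerSpace) : dist w v = ‖w - v‖ :=
  dist_eq_norm (w : C(unitInterval, ℝ)) v

section

variable {μ : Measure WienerSpace} {hμ : IsWienerMeasure μ}
  {V : CameronMartin →ₗᵢ[ℝ] CameronMartin} (e : HilbertBasis ℕ ℝ CameronMartin)
  {X : WienerSpace → WienerSpace}

/-- The indicator of `‖S_n - x‖ > ε` is at most twice the conditional probability of
`‖X - x‖ > ε` given the first `n` coefficients. -/
lemma IsTransport.indicator_partialSum_le_condExp (hX : IsTransport hμ V X) (n : ℕ)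
    (x : WienerSpace) (ε : ℝ) :
    ∀ᵐ w ∂μ, {w | ε < ‖partialSum hμ V e n w - x‖}.indicator (fun _ => (1 : ℝ)) w
      ≤ 2 * (μ[{w | ε < ‖X w - x‖}.indicator (fun _ => (1 : ℝ)) |
        coefficientFiltration hμ V e n]) w := by
  have := hμ.isProbabilityMeasure
  have hm := (coefficientFiltration hμ V e).le n
  set D : Set WienerSpace := {w | ε < ‖partialSum hμ V e n w - x‖}
  set E : Set WienerSpace := {w | ε < ‖X w - x‖}
  have hD : MeasurableSet[coefficientFiltration hμ V e n] D := by
    refine ⟨{y | ε < ‖synthesis e y - x‖},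
      measurable_synthesis e n (measurableSet_norm_sub_gt x ε), ?_⟩
    ext w
    change ε < ‖synthesis e (coefficients hμ V e n w) - x‖ ↔ ε < ‖partialSum hμ V e n w - x‖
    rw [partialSum_eq]
  have hE : MeasurableSet E := hX.measurable (measurableSet_norm_sub_gt x ε)
  have hEi : Integrable (E.indicator fun _ => (1 : ℝ)) μ := (integrable_const 1).indicator hE
  have hDi : Integrable (D.indicator fun _ => (1 : ℝ)) μ := (integrable_const 1).indicator (hm _ hD)
  have hDs : StronglyMeasurable[coefficientFiltration hμ V e n] (D.indicator fun _ => (1 : ℝ)) :=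
    stronglyMeasurable_const.indicator hD
  have hCs : StronglyMeasurable[coefficientFiltration hμ V e n]
      fun w => 2 * (μ[E.indicator (fun _ => (1 : ℝ)) | coefficientFiltration hμ V e n]) w :=
    stronglyMeasurable_condExp.const_mul 2
  refine ae_le_of_ae_le_trim (hm := hm) (ae_le_of_forall_setIntegral_le (hDi.trim hm hDs)
    ((integrable_condExp.const_mul 2).trim hm hCs) fun A hA _ => ?_)
  rw [← setIntegral_trim hm hDs hA, ← setIntegral_trim hm hCs hA, integral_const_mul,
    setIntegral_condExp hm hEi hA, setIntegral_indicator (hm _ hD), setIntegral_indicator hE,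
    setIntegral_const, setIntegral_const, smul_eq_mul, smul_eq_mul, mul_one, mul_one]
  exact hX.measureReal_partialSum_le e n x ε hA

/-- Every `δ(V h)` is a function of the coefficients `δ(V eᵢ)`. -/
lemma aestronglyMeasurable_wienerIntegral_comp (h : CameronMartin) :
    AEStronglyMeasurable[⨆ n, coefficientFiltration hμ V e n] (wienerIntegral hμ (V h)) μ := by
  have hm : (⨆ n, coefficientFiltration hμ V e n : MeasurableSpace WienerSpace) ≤
    borel WienerSpace := iSup_le fun n => (coefficientFiltration hμ V e).le n
  have h1 : ∀ i, wienerIntegral hμ (V (e i)) ∈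
      lpMeas ℝ ℝ (⨆ n, coefficientFiltration hμ V e n) 2 μ := by
    intro i
    rw [mem_lpMeas_iff_aestronglyMeasurable]
    have h2 : Measurable[coefficientFiltration hμ V e (i + 1)] (wienerIntegral hμ (V (e i))) := by
      have h3 : Measurable[coefficientFiltration hμ V e (i + 1)] (coefficients hμ V e (i + 1)) :=
        comap_measurable _
      exact (measurable_pi_apply (Fin.last i)).comp h3
    exact (h2.mono (le_iSup (fun n => coefficientFiltration hμ V e n) (i + 1))
      le_rfl).stronglyMeasurable.aestronglyMeasurable
  have h2 : HasSum (fun i => e.repr h i • wienerIntegral hμ (V (e i)))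
      (wienerIntegral hμ (V h)) := by
    have := ((e.hasSum_repr h).mapL V.toContinuousLinearMap).mapL (wienerIntegral hμ)
    simpa using this
  refine (isClosed_aestronglyMeasurable hm).mem_of_tendsto h2.tendsto_sum_nat
    (Eventually.of_forall fun n => ?_)
  exact mem_lpMeas_iff_aestronglyMeasurable.1
    (Submodule.sum_mem _ fun i _ => Submodule.smul_mem _ (e.repr h i) (h1 i))

/-- Up to a null set, `X` is a measurable function of the coefficients `δ(V eᵢ)`. -/
lemma IsTransport.exists_measurable_iSup (hX : IsTransport hμ V X) :
    ∃ X', Measurable[⨆ n, coefficientFiltration hμ V e n] X' ∧ X =ᵐ[μ] X' := by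
  obtain ⟨g, hg, hgr⟩ := measurableEmbedding_coord_denseSeq.exists_measurable_extend
    measurable_id fun _ => ⟨0⟩
  have hY := fun n : ℕ => aestronglyMeasurable_wienerIntegral_comp (hμ := hμ) (V := V) e
    (CameronMartin.evalRep (TopologicalSpace.denseSeq unitInterval n))
  refine ⟨fun w => g fun n => (hY n).mk _ w,
    hg.comp (@measurable_pi_lambda _ _ _ (_) _ _ fun n => (hY n).stronglyMeasurable_mk.measurable),
    ?_⟩
  filter_upwards [ae_all_iff.2 fun n => (hY n).ae_eq_mk, ae_all_iff.2 fun n : ℕ =>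
    hX.coord_ae_eq (TopologicalSpace.denseSeq unitInterval n)] with w h1 h2
  have h3 := congrFun hgr (X w)
  simp only [Function.comp_apply, id] at h3
  refine h3.symm.trans ?_
  congr 1
  funext n
  rw [← h1 n, ← h2 n]

/-- Lévy's upward theorem for the event `‖X - x‖ > ε`. -/
lemma IsTransport.tendsto_condExp (hX : IsTransport hμ V X) (x : WienerSpace) (ε : ℝ) :
    ∀ᵐ w ∂μ, Tendsto (fun n => (μ[{w | ε < ‖X w - x‖}.indicator (fun _ => (1 : ℝ)) |
      coefficientFiltration hμ V e n]) w) atTop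
      (𝓝 ({w | ε < ‖X w - x‖}.indicator (fun _ => (1 : ℝ)) w)) := by
  have := hμ.isProbabilityMeasure
  have hm : (⨆ n, coefficientFiltration hμ V e n : MeasurableSpace WienerSpace) ≤
    borel WienerSpace := iSup_le fun n => (coefficientFiltration hμ V e).le n
  obtain ⟨X', hX'm, hX'⟩ := hX.exists_measurable_iSup e
  set E : Set WienerSpace := {w | ε < ‖X w - x‖}
  have hE : MeasurableSet E := hX.measurable (measurableSet_norm_sub_gt x ε)
  have hEi : Integrable (E.indicator fun _ => (1 : ℝ)) μ := (integrable_const 1).indicator hE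
  have hmeas : AEStronglyMeasurable[⨆ n, coefficientFiltration hμ V e n]
      (E.indicator fun _ => (1 : ℝ)) μ := by
    refine ⟨{w | ε < ‖X' w - x‖}.indicator fun _ => (1 : ℝ),
      stronglyMeasurable_const.indicator (hX'm (measurableSet_norm_sub_gt x ε)), ?_⟩
    filter_upwards [hX'] with w hw
    by_cases h : ε < ‖X' w - x‖
    · rw [indicator_of_mem (s := E) (show ε < ‖X w - x‖ by rwa [hw]),
        indicator_of_mem (by exact h)]
    · rw [indicator_of_notMem (s := E) (show ¬ ε < ‖X w - x‖ by rwa [hw]),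
        indicator_of_notMem (by exact h)]
  filter_upwards [tendsto_ae_condExp (ℱ := coefficientFiltration hμ V e) (μ := μ)
    (E.indicator fun _ => (1 : ℝ)), condExp_of_aestronglyMeasurable' hm hmeas hEi] with w h1 h2
  rwa [h2] at h1

/-- The partial sums converge uniformly to `X` almost surely. -/
lemma IsTransport.tendsto_partialSum (hX : IsTransport hμ V X) :
    ∀ᵐ w ∂μ, Tendsto (fun n => partialSum hμ V e n w) atTop (𝓝 (X w)) := by
  let x : ℕ → WienerSpace := TopologicalSpace.denseSeq WienerSpace
  -- Only the countably many balls with centre `x m` and radius `1 / (k + 1)` are needed.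
  have hε : ∀ k : ℕ, 0 < 1 / ((k : ℝ) + 1) := fun k => Nat.one_div_pos_of_nat
  have h1 := ae_all_iff.2 fun m => ae_all_iff.2 fun k : ℕ => ae_all_iff.2 fun n =>
    hX.indicator_partialSum_le_condExp e n (x m) (1 / ((k : ℝ) + 1))
  have h2 := ae_all_iff.2 fun m => ae_all_iff.2 fun k : ℕ =>
    hX.tendsto_condExp e (x m) (1 / ((k : ℝ) + 1))
  filter_upwards [h1, h2] with w h1 h2
  rw [Metric.tendsto_atTop]
  intro ε hεpos
  obtain ⟨k, hk⟩ := exists_nat_one_div_lt (half_pos hεpos)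
  obtain ⟨m, hm⟩ := (TopologicalSpace.denseRange_denseSeq WienerSpace).exists_dist_lt (X w) (hε k)
  have hmX : ‖X w - x m‖ < 1 / ((k : ℝ) + 1) := by rwa [← dist_eq_norm_path]
  have h3 := h2 m k
  rw [indicator_of_notMem (by exact hmX.not_gt)] at h3
  -- A conditional probability below `1 / 2` excludes `‖S_n - x m‖ > 1 / (k + 1)`.
  obtain ⟨N, hN⟩ := (h3.eventually
    (gt_mem_nhds (show (0 : ℝ) < 1 / 2 by norm_num))).exists_forall_of_atTop
  refine ⟨N, fun n hn => ?_⟩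
  have h4 : ‖partialSum hμ V e n w - x m‖ ≤ 1 / ((k : ℝ) + 1) := by
    by_contra! hlt
    have h5 := h1 m k n
    rw [indicator_of_mem (by exact hlt)] at h5
    have h6 := hN n hn
    linarith
  calc dist (partialSum hμ V e n w) (X w)
      ≤ dist (partialSum hμ V e n w) (x m) + dist (X w) (x m) := dist_triangle_right _ _ _
    _ < ε := by
      rw [dist_eq_norm_path, dist_eq_norm_path]
      linarith

end

lemma exists_isRotation {μ : Measure WienerSpace} (hμ : IsWienerMeasure μ)
    (R : CameronMartin ≃ₗᵢ[ℝ] CameronMartin) (e : HilbertBasis ℕ ℝ CameronMartin) :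
    ∃ T, IsRotation hμ R e T := by
  obtain ⟨X, hX⟩ := exists_isTransport hμ R.toLinearIsometry
  exact ⟨X, hX.measurable, hX.tendsto_partialSum e⟩

/-- Every version of the rotation is a transport, since the sum of the series is almost surely equal
to some transport. -/
lemma IsRotation.isTransport {μ : Measure WienerSpace} {hμ : IsWienerMeasure μ}
    {R : CameronMartin ≃ₗᵢ[ℝ] CameronMartin} {e : HilbertBasis ℕ ℝ CameronMartin}
    {T : WienerSpace → WienerSpace} (hT : IsRotation hμ R e T) :
    IsTransport hμ R.toLinearIsometry T := by
  obtain ⟨X, hX⟩ := exists_isTransport hμ R.toLinearIsometry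
  refine ⟨hT.measurable, fun t => ?_⟩
  filter_upwards [hX.tendsto_partialSum e, hT.tendsto, hX.coord_ae_eq t] with w h1 h2 h3
  rw [tendsto_nhds_unique h2 h1, h3]

/-! ### Sequences which are null in mean -/

/-- The Cesàro means of `‖aₙ‖` tend to zero. -/
def IsNullInMean {E : Type*} [Norm E] (a : ℕ → E) : Prop :=
  Tendsto (fun n : ℕ => (n : ℝ)⁻¹ * ∑ k ∈ Finset.range n, ‖a k‖) atTop (𝓝 0)

namespace IsNullInMean

variable {E F : Type*} [SeminormedAddCommGroup E] [SeminormedAddCommGroup F] {a b : ℕ → E}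

lemma mono {b : ℕ → F} (hb : IsNullInMean b) (C : ℝ) (h : ∀ n, ‖a n‖ ≤ C * ‖b n‖) :
    IsNullInMean a := by
  have h1 : Tendsto (fun n : ℕ => C * ((n : ℝ)⁻¹ * ∑ k ∈ Finset.range n, ‖b k‖)) atTop (𝓝 0) := by
    simpa using Tendsto.const_mul C hb
  refine squeeze_zero (fun n => by positivity) (fun n => ?_) h1
  rw [mul_left_comm, Finset.mul_sum _ _ C]
  exact mul_le_mul_of_nonneg_left (Finset.sum_le_sum fun k _ => h k)
    (inv_nonneg.2 n.cast_nonneg)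

lemma add (ha : IsNullInMean a) (hb : IsNullInMean b) : IsNullInMean (fun n => a n + b n) := by
  have h1 := Tendsto.add ha hb
  rw [add_zero] at h1
  refine squeeze_zero (fun n => by positivity) (fun n => ?_) h1
  rw [← mul_add, ← Finset.sum_add_distrib]
  gcongr with k
  exact norm_add_le _ _

/-- Being null in mean is stable under uniform limits. -/
lemma of_forall_exists (h : ∀ ε > 0, ∃ b : ℕ → E, IsNullInMean b ∧ ∀ n, ‖a n - b n‖ ≤ ε) :
    IsNullInMean a := by
  rw [IsNullInMean, Metric.tendsto_atTop]
  intro ε hε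
  obtain ⟨b, hb, hab⟩ := h (ε / 2) (half_pos hε)
  obtain ⟨N, hN⟩ := Metric.tendsto_atTop.1 hb (ε / 2) (half_pos hε)
  refine ⟨N, fun n hn => ?_⟩
  have h1 := hN n hn
  have h2 : ∀ c : ℕ → E, 0 ≤ (n : ℝ)⁻¹ * ∑ k ∈ Finset.range n, ‖c k‖ := fun c => by positivity
  rw [Real.dist_0_eq_abs, abs_of_nonneg (h2 _)] at h1 ⊢
  calc (n : ℝ)⁻¹ * ∑ k ∈ Finset.range n, ‖a k‖
      ≤ (n : ℝ)⁻¹ * ∑ k ∈ Finset.range n, (ε / 2 + ‖b k‖) := by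
        gcongr with k
        have h3 := norm_add_le (a k - b k) (b k)
        rw [sub_add_cancel] at h3
        linarith [hab k]
    _ = (n : ℝ)⁻¹ * n * (ε / 2) + (n : ℝ)⁻¹ * ∑ k ∈ Finset.range n, ‖b k‖ := by
        rw [Finset.sum_add_distrib, Finset.sum_const, Finset.card_range, nsmul_eq_mul]
        ring
    _ ≤ 1 * (ε / 2) + (n : ℝ)⁻¹ * ∑ k ∈ Finset.range n, ‖b k‖ := by
        gcongr
        exact inv_mul_le_one
    _ < ε := by linarith

/-- By the Cauchy–Schwarz inequality, it is enough that the means of the squares tend to zero. -/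
lemma of_sq {a : ℕ → E}
    (h : Tendsto (fun n : ℕ => (n : ℝ)⁻¹ * ∑ k ∈ Finset.range n, ‖a k‖ ^ 2) atTop (𝓝 0)) :
    IsNullInMean a := by
  have h1 : Tendsto (fun n : ℕ => √((n : ℝ)⁻¹ * ∑ k ∈ Finset.range n, ‖a k‖ ^ 2)) atTop (𝓝 0) := by
    simpa using h.sqrt
  refine squeeze_zero (fun n => by positivity) (fun n => Real.le_sqrt_of_sq_le ?_) h1
  rcases Nat.eq_zero_or_pos n with rfl | hn
  · simp
  have hn' : (0 : ℝ) < n := Nat.cast_pos.2 hn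
  have h2 := sq_sum_le_card_mul_sum_sq (s := Finset.range n) (f := fun k => ‖a k‖)
  rw [Finset.card_range] at h2
  rw [mul_pow, sq (n : ℝ)⁻¹, mul_assoc]
  gcongr
  rw [inv_mul_le_iff₀ hn']
  exact h2

/-- The vectors `x` for which the values `Bₙ x` of a bounded sequence of linear maps are null in
mean form a closed subspace. -/
lemma of_mem_closure_span {𝕜 : Type*} [RCLike 𝕜] {E F : Type*} [SeminormedAddCommGroup E]
    [NormedSpace 𝕜 E] [SeminormedAddCommGroup F] [NormedSpace 𝕜 F] (B : ℕ → E →ₗ[𝕜] F) {C : ℝ}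
    (hB : ∀ n x, ‖B n x‖ ≤ C * ‖x‖) {S : Set E} (hS : ∀ x ∈ S, IsNullInMean fun n => B n x)
    {x : E} (hx : x ∈ (Submodule.span 𝕜 S).topologicalClosure) : IsNullInMean fun n => B n x := by
  have key : ∀ y ∈ Submodule.span 𝕜 S, IsNullInMean fun n => B n y := by
    intro y hy
    induction hy using Submodule.span_induction with
    | mem y hy => exact hS y hy
    | zero =>
      simp only [map_zero, IsNullInMean, norm_zero, Finset.sum_const_zero, mul_zero]
      exact tendsto_const_nhds
    | add y z _ _ hy hz =>
      simp only [map_add]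
      exact hy.add hz
    | smul c y _ hy =>
      refine hy.mono ‖c‖ fun n => ?_
      rw [map_smul, norm_smul]
  refine of_forall_exists fun ε hε => ?_
  obtain ⟨y, hy, hxy⟩ := Metric.mem_closure_iff.1 hx (ε / (|C| + 1)) (by positivity)
  refine ⟨fun n => B n y, key y hy, fun n => ?_⟩
  rw [← map_sub]
  refine (hB n _).trans ?_
  rw [dist_eq_norm, lt_div_iff₀ (by positivity)] at hxy
  nlinarith [le_abs_self C, norm_nonneg (x - y)]

end IsNullInMean

/-! ### Exponentials of Wiener integrals -/

section

variable {μ : Measure WienerSpace} (hμ : IsWienerMeasure μ)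

/-- An integrable function is determined by its integrals against the `exp (i δh)`: the measures
with densities `u⁺` and `u⁻` have the same characteristic functional. -/
lemma ae_eq_zero_of_integral_exp_mul {u : WienerSpace → ℝ} (hu : Integrable u μ)
    (h : ∀ h, ∫ w, Complex.exp (wienerIntegral hμ h w * Complex.I) * u w ∂μ = 0) :
    u =ᵐ[μ] 0 := by
  have := hμ.isProbabilityMeasure
  have hfin : ∀ v : WienerSpace → ℝ, Integrable v μ →
      IsFiniteMeasure (μ.withDensity fun w => ENNReal.ofReal (v w)) := fun v hv =>
    isFiniteMeasure_withDensity_ofReal hv.2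
  have := hfin u hu
  have := hfin (fun w => -u w) hu.neg
  have hmeas : ∀ v : WienerSpace → ℝ, Integrable v μ →
      AEMeasurable (fun w => ENNReal.ofReal (v w)) μ := fun v hv =>
    hv.aestronglyMeasurable.aemeasurable.ennreal_ofReal
  have hPQ : (μ.withDensity fun w => ENNReal.ofReal (u w))
      = μ.withDensity fun w => ENNReal.ofReal (-u w) := by
    refine measure_ext_of_integral_exp coordLinear continuous_coord coord_separates fun c => ?_
    have hφ : Continuous fun v : WienerSpace =>
        Complex.exp ((c.sum fun t a => a * coordLinear t v : ℝ) * Complex.I) := by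
      have : ∀ t, Continuous fun v => coordLinear t v := continuous_coord
      simp only [Finsupp.sum]
      fun_prop
    set φ : WienerSpace → ℂ := fun v =>
      Complex.exp ((c.sum fun t a => a * coordLinear t v : ℝ) * Complex.I) with hφdef
    have hφ1 : ∀ w, ‖φ w‖ ≤ 1 := fun w => (Complex.norm_exp_ofReal_mul_I _).le
    have hint : ∀ v : WienerSpace → ℝ, Integrable v μ →
        Integrable (fun w => (ENNReal.ofReal (v w)).toReal • φ w) μ := by
      intro v hv
      refine hv.norm.mono' ((hmeas v hv).ennreal_toReal.aestronglyMeasurable.smul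
        hφ.aestronglyMeasurable) (Eventually.of_forall fun w => ?_)
      rw [norm_smul, Real.norm_of_nonneg ENNReal.toReal_nonneg, ENNReal.toReal_ofReal']
      calc max (v w) 0 * ‖φ w‖ ≤ max (v w) 0 * 1 := by gcongr; exact hφ1 w
        _ ≤ ‖v w‖ := by
          rw [mul_one]
          exact max_le (le_abs_self _) (abs_nonneg _)
    have hden : ∀ v : WienerSpace → ℝ, Integrable v μ →
        ∫ w, φ w ∂(μ.withDensity fun w => ENNReal.ofReal (v w))
          = ∫ w, (ENNReal.ofReal (v w)).toReal • φ w ∂μ := fun v hv =>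
      integral_withDensity_eq_integral_toReal_smul₀ (hmeas v hv)
        (Eventually.of_forall fun w => ENNReal.ofReal_lt_top) φ
    change ∫ w, φ w ∂_ = ∫ w, φ w ∂_
    rw [hden u hu, hden (fun w => -u w) hu.neg, ← sub_eq_zero,
      ← integral_sub (hint u hu) (hint (fun w => -u w) hu.neg),
      ← h (Finsupp.linearCombination ℝ CameronMartin.evalRep c)]
    refine integral_congr_ae ?_
    filter_upwards [ae_eq_wienerIntegral_linearCombination hμ (coord_ae_eq_wienerIntegral hμ) c]
      with w hw
    rw [← hw, ← sub_smul, ENNReal.toReal_ofReal', ENNReal.toReal_ofReal',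
      max_zero_sub_max_neg_zero_eq_self, Complex.real_smul, mul_comm]
    rfl
  have h1 : (fun w => ENNReal.ofReal (u w)) =ᵐ[μ] fun w => ENNReal.ofReal (-u w) :=
    (withDensity_eq_iff_of_sigmaFinite (hmeas u hu) (hmeas (fun w => -u w) hu.neg)).1 hPQ
  filter_upwards [h1] with w hw
  rcases le_total 0 (u w) with h0 | h0
  · rw [ENNReal.ofReal_of_nonpos (p := -u w) (by linarith), ENNReal.ofReal_eq_zero] at hw
    exact le_antisymm hw h0
  · rw [ENNReal.ofReal_of_nonpos h0, eq_comm, ENNReal.ofReal_eq_zero] at hw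
    exact le_antisymm h0 (neg_nonpos.1 hw)

lemma memLp_exp_wienerIntegral (h : CameronMartin) :
    MemLp (fun w => Complex.exp (wienerIntegral hμ h w * Complex.I)) 2 μ := by
  have := hμ.isProbabilityMeasure
  refine MemLp.of_bound ?_ 1 (Eventually.of_forall fun w => (Complex.norm_exp_ofReal_mul_I _).le)
  exact Continuous.comp_aestronglyMeasurable (g := fun x : ℝ => Complex.exp (x * Complex.I))
    (by fun_prop) (Lp.aestronglyMeasurable _)

/-- The function `exp (i δh)` in `L²(μ; ℂ)`. -/
def expWiener (h : CameronMartin) : Lp ℂ 2 μ := (memLp_exp_wienerIntegral hμ h).toLp _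

lemma coeFn_expWiener (h : CameronMartin) :
    expWiener hμ h =ᵐ[μ] fun w => Complex.exp (wienerIntegral hμ h w * Complex.I) :=
  (memLp_exp_wienerIntegral hμ h).coeFn_toLp

lemma expWiener_zero : expWiener hμ 0 =ᵐ[μ] fun _ => 1 := by
  filter_upwards [coeFn_expWiener hμ 0, Lp.coeFn_zero ℝ 2 μ] with w h1 h2
  rw [h1, map_zero, h2]
  simp

lemma inner_expWiener (h k : CameronMartin) : inner ℂ (expWiener hμ h) (expWiener hμ k)
    = Complex.exp ((-(‖k - h‖ ^ 2 / 2) : ℝ) : ℂ) := by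
  rw [← integral_exp_wienerIntegral hμ, L2.inner_def]
  refine integral_congr_ae ?_
  filter_upwards [coeFn_expWiener hμ h, coeFn_expWiener hμ k,
    Lp.coeFn_sub (wienerIntegral hμ k) (wienerIntegral hμ h)] with w h1 h2 h3
  rw [h1, h2, map_sub, h3, RCLike.inner_apply, ← Complex.exp_conj, ← Complex.exp_add]
  congr 1
  simp
  ring

/-- The exponentials `exp (i δh)` are total in `L²(μ; ℂ)`. -/
lemma topologicalClosure_span_expWiener :
    (Submodule.span ℂ (range (expWiener hμ))).topologicalClosure = ⊤ := by
  have := hμ.isProbabilityMeasure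
  rw [Submodule.topologicalClosure_eq_top_iff, Submodule.eq_bot_iff]
  intro f hf
  rw [Submodule.mem_orthogonal] at hf
  have hfi : Integrable f μ := (Lp.memLp f).integrable (by norm_num)
  have h0 : ∀ h, ∫ w, Complex.exp (wienerIntegral hμ h w * Complex.I) * f w ∂μ = 0 := by
    intro h
    have h1 := hf (expWiener hμ (-h)) (Submodule.subset_span (mem_range_self _))
    rw [L2.inner_def] at h1
    rw [← h1]
    refine integral_congr_ae ?_
    filter_upwards [coeFn_expWiener hμ (-h), Lp.coeFn_neg (wienerIntegral hμ h)] with w h2 h3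
    rw [h2, map_neg, h3, RCLike.inner_apply, ← Complex.exp_conj, mul_comm]
    congr 2
    simp
  have hei : ∀ h (g : WienerSpace → ℂ), Integrable g μ →
      Integrable (fun w => Complex.exp (wienerIntegral hμ h w * Complex.I) * g w) μ := by
    intro h g hg
    refine hg.norm.mono' ((memLp_exp_wienerIntegral hμ h).1.mul hg.1)
      (Eventually.of_forall fun w => ?_)
    rw [norm_mul, Complex.norm_exp_ofReal_mul_I, one_mul]
  have hfc : Integrable (fun w => (starRingEnd ℂ) (f w)) μ :=
    hfi.norm.mono' (Complex.continuous_conj.comp_aestronglyMeasurable hfi.1)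
      (Eventually.of_forall fun w => by rw [RCLike.norm_conj])
  have h0c : ∀ h, ∫ w, Complex.exp (wienerIntegral hμ h w * Complex.I) *
      (starRingEnd ℂ) (f w) ∂μ = 0 := by
    intro h
    have h1 := congrArg (starRingEnd ℂ) (h0 (-h))
    rw [map_zero, ← integral_conj] at h1
    rw [← h1]
    refine integral_congr_ae ?_
    filter_upwards [Lp.coeFn_neg (wienerIntegral hμ h)] with w h3
    rw [map_mul, ← Complex.exp_conj, map_neg, h3]
    congr 2
    simp
  have hre : (fun w => (f w).re) =ᵐ[μ] 0 := by
    refine ae_eq_zero_of_integral_exp_mul hμ hfi.re fun h => ?_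
    have h1 : ∫ w, (Complex.exp (wienerIntegral hμ h w * Complex.I) * f w +
        Complex.exp (wienerIntegral hμ h w * Complex.I) * (starRingEnd ℂ) (f w)) ∂μ = 0 := by
      rw [integral_add (hei h _ hfi) (hei h _ hfc), h0, h0c, add_zero]
    have h2 : ∀ w, Complex.exp (wienerIntegral hμ h w * Complex.I) * ((f w).re : ℂ)
        = (1 / 2 : ℂ) * (Complex.exp (wienerIntegral hμ h w * Complex.I) * f w +
        Complex.exp (wienerIntegral hμ h w * Complex.I) * (starRingEnd ℂ) (f w)) := by
      intro w
      rw [← mul_add, Complex.add_conj]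
      push_cast
      ring
    simp only [h2]
    rw [integral_const_mul, h1, mul_zero]
  have him : (fun w => (f w).im) =ᵐ[μ] 0 := by
    refine ae_eq_zero_of_integral_exp_mul hμ hfi.im fun h => ?_
    have h1 : ∫ w, (Complex.exp (wienerIntegral hμ h w * Complex.I) * f w -
        Complex.exp (wienerIntegral hμ h w * Complex.I) * (starRingEnd ℂ) (f w)) ∂μ = 0 := by
      rw [integral_sub (hei h _ hfi) (hei h _ hfc), h0, h0c, sub_zero]
    have h2 : ∀ w, Complex.exp (wienerIntegral hμ h w * Complex.I) * ((f w).im : ℂ)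
        = (-Complex.I / 2 : ℂ) * (Complex.exp (wienerIntegral hμ h w * Complex.I) * f w -
        Complex.exp (wienerIntegral hμ h w * Complex.I) * (starRingEnd ℂ) (f w)) := by
      intro w
      rw [← mul_sub, Complex.sub_conj]
      push_cast
      linear_combination (Complex.exp (wienerIntegral hμ h w * Complex.I) * (f w).im) *
        Complex.I_sq
    simp only [h2]
    rw [integral_const_mul, h1, mul_zero]
  rw [Lp.eq_zero_iff_ae_eq_zero]
  filter_upwards [hre, him] with w h1 h2
  exact Complex.ext h1 h2

end

/-! ### Weak mixing -/

section

variable {μ : Measure WienerSpace} {hμ : IsWienerMeasure μ}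
  {V : CameronMartin →ₗᵢ[ℝ] CameronMartin} {T : WienerSpace → WienerSpace}

lemma IsTransport.wienerIntegral_iterate (hT : IsTransport hμ V T) (h : CameronMartin) (n : ℕ) :
    (fun w => wienerIntegral hμ h (T^[n] w)) =ᵐ[μ] wienerIntegral hμ (V^[n] h) := by
  induction n with
  | zero => rfl
  | succ n ih =>
    rw [Function.iterate_succ_apply']
    refine EventuallyEq.trans ?_ (hT.wienerIntegral_comp (V^[n] h))
    exact hT.measurePreserving.quasiMeasurePreserving.ae_eq_comp ih

lemma abs_exp_sub_one_le_mul_exp (x : ℝ) : |Real.exp x - 1| ≤ |x| * Real.exp |x| := by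
  have h1 := Real.add_one_le_exp x
  have h2 := Real.add_one_le_exp (-x)
  have h3 : Real.exp x * Real.exp (-x) = 1 := by rw [← Real.exp_add]; simp
  have h4 : Real.exp x - 1 ≤ x * Real.exp x := by nlinarith [Real.exp_pos x]
  rcases le_total 0 x with hx | hx
  · rw [abs_of_nonneg hx, abs_of_nonneg (by linarith)]
    exact h4
  · rw [abs_of_nonpos hx, abs_of_nonpos (by linarith [Real.exp_le_one_iff.2 hx])]
    nlinarith [Real.one_le_exp (neg_nonneg.2 hx)]

/-- The Koopman operator of `Tⁿ` on `L²(μ; ℂ)`. -/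
def IsTransport.koopman (hT : IsTransport hμ V T) (n : ℕ) : Lp ℂ 2 μ →ₗᵢ[ℂ] Lp ℂ 2 μ :=
  Lp.compMeasurePreservingₗᵢ ℂ T^[n] (hT.measurePreserving.iterate n)

lemma IsTransport.coeFn_koopman (hT : IsTransport hμ V T) (n : ℕ) (f : Lp ℂ 2 μ) :
    hT.koopman n f =ᵐ[μ] fun w => f (T^[n] w) :=
  Lp.coeFn_compMeasurePreserving f (hT.measurePreserving.iterate n)

lemma IsTransport.koopman_expWiener (hT : IsTransport hμ V T) (n : ℕ) (h : CameronMartin) :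
    hT.koopman n (expWiener hμ h) = expWiener hμ (V^[n] h) := by
  refine Lp.ext ?_
  have h1 := (hT.measurePreserving.iterate n).quasiMeasurePreserving.ae_eq_comp
    (coeFn_expWiener hμ h)
  filter_upwards [hT.coeFn_koopman n (expWiener hμ h), h1, hT.wienerIntegral_iterate h n,
    coeFn_expWiener hμ (V^[n] h)] with w h1 h2 h3 h4
  simp only [Function.comp_apply] at h2
  rw [h1, h2, h3, h4]

/-- The correlation of `exp (i δh)` and `exp (i δk) ∘ Tⁿ` is governed by `(Vⁿ k, h)`. -/
lemma IsTransport.norm_correlation_expWiener_le (hT : IsTransport hμ V T) (n : ℕ)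
    (h k : CameronMartin) :
    ‖inner ℂ (expWiener hμ h) (hT.koopman n (expWiener hμ k))
      - inner ℂ (expWiener hμ h) (expWiener hμ 0) * inner ℂ (expWiener hμ 0) (expWiener hμ k)‖
      ≤ Real.exp (‖k‖ * ‖h‖) * ‖(inner ℝ (V^[n] k) h : ℝ)‖ := by
  have hnorm : ‖V^[n] k‖ = ‖k‖ := by
    induction n with
    | zero => rfl
    | succ n ih => rw [Function.iterate_succ_apply', V.norm_map, ih]
  set r : ℝ := inner ℝ (V^[n] k) h
  have hr : |r| ≤ ‖k‖ * ‖h‖ := by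
    have := abs_real_inner_le_norm (V^[n] k) h
    rwa [hnorm] at this
  rw [hT.koopman_expWiener, inner_expWiener, inner_expWiener, inner_expWiener, ← Complex.ofReal_exp,
    ← Complex.ofReal_exp, ← Complex.ofReal_exp, ← Complex.ofReal_mul, ← Complex.ofReal_sub,
    Complex.norm_real, ← Real.exp_add, norm_sub_sq_real, hnorm, zero_sub, norm_neg, sub_zero,
    Real.norm_eq_abs, Real.norm_eq_abs]
  have h1 : Real.exp (-((‖k‖ ^ 2 - 2 * r + ‖h‖ ^ 2) / 2))
      - Real.exp (-(‖h‖ ^ 2 / 2) + -(‖k‖ ^ 2 / 2))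
      = Real.exp (-(‖h‖ ^ 2 / 2) + -(‖k‖ ^ 2 / 2)) * (Real.exp r - 1) := by
    rw [mul_sub, ← Real.exp_add, mul_one]
    congr 2
    ring
  rw [h1, abs_mul, abs_of_pos (Real.exp_pos _)]
  calc Real.exp (-(‖h‖ ^ 2 / 2) + -(‖k‖ ^ 2 / 2)) * |Real.exp r - 1|
      ≤ 1 * (|r| * Real.exp |r|) := by
        gcongr
        · exact Real.exp_le_one_iff.2 (by nlinarith [sq_nonneg ‖h‖, sq_nonneg ‖k‖])
        · exact abs_exp_sub_one_le_mul_exp r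
    _ ≤ Real.exp (‖k‖ * ‖h‖) * |r| := by
        rw [one_mul, mul_comm]
        gcongr

/-- If the matrix coefficients of `Vⁿ` are null in mean, then so are all correlations of `T`; the
constant function `1` is written `exp (i δ0)`. -/
lemma IsTransport.isNullInMean_correlation (hT : IsTransport hμ V T)
    (hV : ∀ h k, IsNullInMean fun n => (inner ℝ (V^[n] k) h : ℝ)) (f g : Lp ℂ 2 μ) :
    IsNullInMean fun n => inner ℂ f (hT.koopman n g)
      - inner ℂ f (expWiener hμ 0) * inner ℂ (expWiener hμ 0) g := by
  have hnorm : ‖expWiener hμ 0‖ = 1 := by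
    have h1 := inner_expWiener hμ 0 0
    rw [inner_self_eq_norm_sq_to_K] at h1
    simp only [sub_self, norm_zero] at h1
    have h2 : ‖expWiener hμ 0‖ ^ 2 = 1 := by
      have := congrArg Complex.re h1
      simpa [← Complex.ofReal_pow] using this
    nlinarith [norm_nonneg (expWiener hμ 0)]
  have hbound : ∀ n (f g : Lp ℂ 2 μ), ‖inner ℂ f (hT.koopman n g)
      - inner ℂ f (expWiener hμ 0) * inner ℂ (expWiener hμ 0) g‖ ≤ 2 * (‖f‖ * ‖g‖) := by
    intro n f g
    have h1 := norm_inner_le_norm (𝕜 := ℂ) f (hT.koopman n g)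
    have h2 := norm_inner_le_norm (𝕜 := ℂ) f (expWiener hμ 0)
    have h3 := norm_inner_le_norm (𝕜 := ℂ) (expWiener hμ 0) g
    rw [LinearIsometry.norm_map] at h1
    rw [hnorm, mul_one] at h2
    rw [hnorm, one_mul] at h3
    refine (norm_sub_le _ _).trans ?_
    rw [norm_mul]
    have h4 := mul_le_mul h2 h3 (norm_nonneg _) (norm_nonneg _)
    linarith
  have hmem : ∀ f : Lp ℂ 2 μ,
      f ∈ (Submodule.span ℂ (range (expWiener hμ))).topologicalClosure := fun f => by
    rw [topologicalClosure_span_expWiener]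
    trivial
  -- By totality of the exponentials, extend from `exp (i δk)` to `g`, then from `exp (i δh)`
  -- to `f`.
  have step : ∀ h (g : Lp ℂ 2 μ), IsNullInMean fun n =>
      inner ℂ (expWiener hμ h) (hT.koopman n g)
        - inner ℂ (expWiener hμ h) (expWiener hμ 0) * inner ℂ (expWiener hμ 0) g := by
    intro h g
    refine IsNullInMean.of_mem_closure_span (𝕜 := ℂ) (C := 2 * ‖expWiener hμ h‖)
      (fun n => (innerₛₗ ℂ (expWiener hμ h)).comp (hT.koopman n).toLinearMap
        - inner ℂ (expWiener hμ h) (expWiener hμ 0) • innerₛₗ ℂ (expWiener hμ 0))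
      (fun n g => ?_) ?_ (hmem g)
    · rw [mul_assoc]
      exact hbound n _ g
    · rintro _ ⟨k, rfl⟩
      exact (hV h k).mono _ fun n => hT.norm_correlation_expWiener_le n h k
  have hswap : ∀ n (f : Lp ℂ 2 μ),
      inner ℂ (hT.koopman n g - inner ℂ (expWiener hμ 0) g • expWiener hμ 0) f
        = (starRingEnd ℂ) (inner ℂ f (hT.koopman n g)
          - inner ℂ f (expWiener hμ 0) * inner ℂ (expWiener hμ 0) g) := by
    intro n f
    rw [← inner_conj_symm, inner_sub_right, inner_smul_right, mul_comm]
  have h2 : IsNullInMean fun n =>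
      (innerₛₗ ℂ (hT.koopman n g - inner ℂ (expWiener hμ 0) g • expWiener hμ 0)) f := by
    refine IsNullInMean.of_mem_closure_span (𝕜 := ℂ) (C := 2 * ‖g‖)
      (fun n => innerₛₗ ℂ (hT.koopman n g - inner ℂ (expWiener hμ 0) g • expWiener hμ 0))
      (fun n f => ?_) ?_ (hmem f)
    · rw [innerₛₗ_apply_apply, hswap, RCLike.norm_conj]
      refine (hbound n f g).trans_eq (by ring)
    · rintro _ ⟨h, rfl⟩
      refine (step h g).mono 1 fun n => ?_
      rw [innerₛₗ_apply_apply, hswap, RCLike.norm_conj, one_mul]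
  refine h2.mono 1 fun n => ?_
  rw [innerₛₗ_apply_apply, hswap, RCLike.norm_conj, one_mul]

lemma IsTransport.isWeakMixing (hT : IsTransport hμ V T)
    (hV : ∀ h k, IsNullInMean fun n => (inner ℝ (V^[n] k) h : ℝ)) : IsWeakMixing T μ := by
  have := hμ.isProbabilityMeasure
  refine ⟨hT.measurePreserving, fun A B hA hB => ?_⟩
  have hone : ∀ (C : Set WienerSpace) (hC : MeasurableSet C),
      inner ℂ (indicatorConstLp 2 hC (measure_ne_top μ C) (1 : ℂ)) (expWiener hμ 0) = μ.real C := by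
    intro C hC
    rw [L2.inner_indicatorConstLp_one,
      setIntegral_congr_ae hC ((expWiener_zero hμ).mono fun w hw _ => hw)]
    simp
  have h1 := hT.isNullInMean_correlation hV (indicatorConstLp 2 hB (measure_ne_top μ B) 1)
    (indicatorConstLp 2 hA (measure_ne_top μ A) 1)
  have h2 : ∀ n, inner ℂ (indicatorConstLp 2 hB (measure_ne_top μ B) (1 : ℂ))
      (hT.koopman n (indicatorConstLp 2 hA (measure_ne_top μ A) 1))
      = (μ.real (T^[n] ⁻¹' A ∩ B) : ℂ) := by
    intro n
    have h3 := (hT.measurePreserving.iterate n)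
    have h4 : hT.koopman n (indicatorConstLp 2 hA (measure_ne_top μ A) 1)
        = indicatorConstLp 2 (h3.measurable hA) (measure_ne_top μ _) (1 : ℂ) := by
      refine Lp.ext ?_
      filter_upwards [hT.coeFn_koopman n (indicatorConstLp 2 hA (measure_ne_top μ A) 1),
        h3.quasiMeasurePreserving.ae_eq_comp (indicatorConstLp_coeFn (p := 2) (hs := hA)
          (hμs := measure_ne_top μ A) (c := (1 : ℂ))),
        indicatorConstLp_coeFn (p := 2) (hs := h3.measurable hA)
          (hμs := measure_ne_top μ _) (c := (1 : ℂ))] with w h5 h6 h7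
      rw [h5, h7]
      exact h6
    rw [h4, L2.inner_indicatorConstLp_one_indicatorConstLp_one, inter_comm]
    rfl
  refine h1.congr fun n => ?_
  congr 1
  refine Finset.sum_congr rfl fun k _ => ?_
  beta_reduce
  rw [h2, hone, ← inner_conj_symm, hone, Complex.conj_ofReal, ← Complex.ofReal_mul,
    ← Complex.ofReal_sub, Complex.norm_real, Real.norm_eq_abs, mul_comm (μ.real B)]

end

/-- For an invariant set `s`, the means in the definition of weak mixing with `A = B = s` are all
equal to `|μ(s) - μ(s)²|`. -/
lemma IsWeakMixing.ergodic {Ω : Type*} [MeasurableSpace Ω] {μ : Measure Ω} [IsProbabilityMeasure μ]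
    {T : Ω → Ω} (hT : IsWeakMixing T μ) : Ergodic T μ := by
  refine ⟨hT.measurePreserving, ⟨fun s hs hinv => ?_⟩⟩
  have h1 := hT.tendsto s s hs hs
  have h2 : ∀ k, T^[k] ⁻¹' s = s := by
    intro k
    induction k with
    | zero => rfl
    | succ k ih => rw [Function.iterate_succ, preimage_comp, ih, hinv]
  simp only [h2, inter_self, Finset.sum_const, Finset.card_range, nsmul_eq_mul] at h1
  have h3 : Tendsto (fun n : ℕ => (n : ℝ)⁻¹ * (n * |μ.real s - μ.real s * μ.real s|)) atTop
      (𝓝 |μ.real s - μ.real s * μ.real s|) := by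
    refine tendsto_const_nhds.congr' ?_
    filter_upwards [eventually_gt_atTop 0] with n hn
    rw [inv_mul_cancel_left₀ (Nat.cast_ne_zero.2 hn.ne')]
  have h4 := tendsto_nhds_unique h3 h1
  rw [abs_eq_zero] at h4
  have h5 : μ.real s * (1 - μ.real s) = 0 := by linarith
  rw [Filter.eventuallyConst_set']
  rcases mul_eq_zero.1 h5 with h | h
  · left
    rw [measureReal_eq_zero_iff] at h
    exact ae_eq_empty.2 h
  · right
    rw [ae_eq_univ, ← measureReal_eq_zero_iff, probReal_compl_eq_one_sub hs]
    exact h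

/-! ### Powers of an isometry and its resolution of the identity -/

section

variable {K : Type*} [NormedAddCommGroup K] [InnerProductSpace ℂ K] {P : ℝ → K →L[ℂ] K}

namespace IsResolutionOfIdentity

variable (hP : IsResolutionOfIdentity P)
include hP

lemma apply_apply_of_le {s t : ℝ} (hst : s ≤ t) (z : K) : P s (P t z) = P s z :=
  congrArg (fun f : K →L[ℂ] K => f z) (hP.mul_of_le s t hst)

lemma inner_apply_left (θ : ℝ) (x y : K) : inner ℂ (P θ x) y = inner ℂ x (P θ y) :=
  (hP.isSymmetricProjection θ).isSymmetric x y

lemma apply_apply_of_ge {s t : ℝ} (hst : s ≤ t) (z : K) : P t (P s z) = P s z := by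
  refine ext_inner_right ℂ fun y => ?_
  rw [hP.inner_apply_left, hP.inner_apply_left, hP.apply_apply_of_le hst, hP.inner_apply_left]

lemma stieltjes_apply (z : K) (θ : ℝ) : hP.stieltjes z θ = ‖P θ z‖ ^ 2 := hP.inner_self θ z

lemma norm_sub_sq {s t : ℝ} (hst : s ≤ t) (z : K) :
    ‖P t z - P s z‖ ^ 2 = ‖P t z‖ ^ 2 - ‖P s z‖ ^ 2 := by
  have h1 : inner ℂ (P t z) (P s z) = inner ℂ (P s z) (P s z) := by
    rw [hP.inner_apply_left, hP.apply_apply_of_ge hst]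
    conv_rhs => rw [hP.inner_apply_left, hP.apply_apply_of_ge le_rfl]
  rw [_root_.norm_sub_sq (𝕜 := ℂ), h1, inner_self_eq_norm_sq]
  ring

lemma tendsto_stieltjes_atBot (z : K) : Tendsto (hP.stieltjes z) atBot (𝓝 0) := by
  refine tendsto_const_nhds.congr' ?_
  filter_upwards [eventually_le_atBot 0] with θ hθ
  rw [hP.stieltjes_apply, hP.eq_zero θ hθ]
  simp

lemma tendsto_stieltjes_atTop (z : K) : Tendsto (hP.stieltjes z) atTop (𝓝 (‖z‖ ^ 2)) := by
  refine tendsto_const_nhds.congr' ?_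
  filter_upwards [eventually_ge_atTop (2 * Real.pi)] with θ hθ
  rw [hP.stieltjes_apply, hP.eq_one θ hθ]
  simp

lemma measure_univ (z : K) :
    (hP.stieltjes z).measure univ = ENNReal.ofReal (‖z‖ ^ 2) := by
  rw [StieltjesFunction.measure_univ _ (hP.tendsto_stieltjes_atBot z)
    (hP.tendsto_stieltjes_atTop z), sub_zero]

lemma isFiniteMeasure (z : K) : IsFiniteMeasure (hP.stieltjes z).measure :=
  ⟨by rw [hP.measure_univ]; exact ENNReal.ofReal_lt_top⟩

lemma measure_Ioc (z : K) (a b : ℝ) : (hP.stieltjes z).measure (Ioc a b)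
    = ENNReal.ofReal (‖P b z‖ ^ 2 - ‖P a z‖ ^ 2) := by
  rw [StieltjesFunction.measure_Ioc, hP.stieltjes_apply, hP.stieltjes_apply]

/-- The spectral measure of a vector of the range of `Π_b - Π_a` lives on `(a, b]`. -/
lemma ae_mem_Ioc {a b : ℝ} {z : K} (ha : P a z = 0) (hb : P b z = z) :
    ∀ᵐ θ ∂(hP.stieltjes z).measure, θ ∈ Ioc a b := by
  have := hP.isFiniteMeasure z
  rw [ae_iff, ← compl_def, measure_compl measurableSet_Ioc (measure_ne_top _ _), hP.measure_univ,
    hP.measure_Ioc, ha, hb]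
  simp

/-- The spectral measures of two vectors, one in the range and one in the kernel of some `Π_s`,
add up to that of their sum. -/
lemma stieltjes_add {s : ℝ} {x y : K} (hx : P s x = x) (hy : P s y = 0) :
    hP.stieltjes (x + y) = hP.stieltjes x + hP.stieltjes y := by
  ext θ
  have h1 : inner ℂ (P θ x) y = 0 := by
    have h2 : P s (P θ x) = P θ x := by
      rcases le_total s θ with h | h
      · rw [hP.apply_apply_of_le h, ← hx, hP.apply_apply_of_ge h, hP.apply_apply_of_ge le_rfl]
      · exact hP.apply_apply_of_ge h x
    rw [← h2, hP.inner_apply_left, hy, inner_zero_right]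
  have h2 : inner ℂ (P θ y) x = 0 := by
    rw [hP.inner_apply_left, ← inner_conj_symm, h1, map_zero]
  change (inner ℂ (P θ (x + y)) (x + y)).re = (inner ℂ (P θ x) x).re + (inner ℂ (P θ y) y).re
  rw [map_add, inner_add_left, inner_add_right, inner_add_right, h1, h2, add_zero, zero_add,
    Complex.add_re]

end IsResolutionOfIdentity

lemma norm_exp_I_mul (θ : ℝ) : ‖Complex.exp (Complex.I * θ)‖ = 1 := by
  rw [mul_comm, Complex.norm_exp_ofReal_mul_I]

lemma norm_exp_I_mul_sub_le (a b : ℝ) :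
    ‖Complex.exp (Complex.I * a) - Complex.exp (Complex.I * b)‖ ≤ |a - b| := by
  have h : Complex.exp (Complex.I * a) - Complex.exp (Complex.I * b)
      = Complex.exp (Complex.I * b) * (Complex.exp (Complex.I * ((a - b : ℝ) : ℂ)) - 1) := by
    rw [mul_sub, ← Complex.exp_add, mul_one]
    congr 2
    push_cast
    ring
  rw [h, norm_mul, norm_exp_I_mul, one_mul]
  exact Real.norm_exp_I_mul_ofReal_sub_one_le

lemma integrable_exp_I_mul (ν : Measure ℝ) [IsFiniteMeasure ν] (c : ℝ) :
    Integrable (fun θ : ℝ => Complex.exp (Complex.I * (c * θ : ℝ))) ν :=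
  Integrable.of_bound (C := 1) (by fun_prop : Continuous fun θ : ℝ =>
    Complex.exp (Complex.I * (c * θ : ℝ))).aestronglyMeasurable
    (Eventually.of_forall fun θ => (norm_exp_I_mul _).le)

variable {U : K →ₗ[ℂ] K}

lemma norm_pow_apply_sub_le (hU : ∀ z, ‖U z‖ = ‖z‖) {c : ℂ} (hc : ‖c‖ = 1) (z : K)
    (n : ℕ) : ‖(U ^ n) z - c ^ n • z‖ ≤ n * ‖U z - c • z‖ := by
  have hUn : ∀ (n : ℕ) (z : K), ‖(U ^ n) z‖ = ‖z‖ := by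
    intro n
    induction n with
    | zero => exact fun z => rfl
    | succ n ih => intro z; rw [pow_succ', Module.End.mul_apply, hU, ih]
  induction n with
  | zero => simp
  | succ n ih =>
    have h1 : (U ^ (n + 1)) z - c ^ (n + 1) • z
        = (U ^ n) (U z - c • z) + c • ((U ^ n) z - c ^ n • z) := by
      rw [pow_succ, Module.End.mul_apply, map_sub, map_smul, smul_sub, smul_smul, pow_succ']
      abel
    rw [h1]
    refine (norm_add_le _ _).trans ?_
    rw [hUn, norm_smul, hc, one_mul]
    push_cast
    linarith

namespace IsSpectralResolution

variable (hUP : IsSpectralResolution U P)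
include hUP

/-- The ranges of `Π_s` and of `1 - Π_s` are orthogonal under the sesquilinear form of `U`: by
`stieltjes_add` the quadratic form of `U` is additive on `x + y` and on `x + iy`. -/
lemma inner_eq_zero {s : ℝ} {x y : K} (hx : P s x = x) (hy : P s y = 0) :
    inner ℂ x (U y) = 0 ∧ inner ℂ y (U x) = 0 := by
  have hP := hUP.isResolution
  have key : ∀ y, P s y = 0 → inner ℂ x (U y) + inner ℂ y (U x) = 0 := by
    intro y hy
    have h1 := hUP.integral_eq (x + y)
    have := hP.isFiniteMeasure x
    have := hP.isFiniteMeasure y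
    have hi : ∀ z, Integrable (fun θ : ℝ => Complex.exp (Complex.I * θ))
        (hP.stieltjes z).measure := fun z => by
      have := hP.isFiniteMeasure z
      simpa using integrable_exp_I_mul (hP.stieltjes z).measure 1
    rw [hP.stieltjes_add hx hy, StieltjesFunction.measure_add, integral_add_measure (hi x) (hi y),
      ← hUP.integral_eq, ← hUP.integral_eq, map_add, inner_add_left, inner_add_right,
      inner_add_right] at h1
    linear_combination h1
  have h1 := key y hy
  have h2 := key (Complex.I • y) (by rw [map_smul, hy, smul_zero])
  rw [map_smul, inner_smul_right, inner_smul_left, Complex.conj_I] at h2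
  have h3 : inner ℂ x (U y) - inner ℂ y (U x) = 0 := by
    have := congrArg (fun c => -Complex.I * c) h2
    simp only [mul_zero] at this
    linear_combination this + (inner ℂ x (U y) - inner ℂ y (U x)) * Complex.I_sq
  constructor
  · linear_combination (h1 + h3) / 2
  · linear_combination (h1 - h3) / 2

/-- `U` commutes with its resolution of the identity. -/
lemma apply_comm (s : ℝ) (z : K) : P s (U z) = U (P s z) := by
  have hP := hUP.isResolution
  have hidem : ∀ z, P s (P s z) = P s z := fun z => hP.apply_apply_of_ge le_rfl z
  have h1 : ∀ x, P s x = x → P s (U x) = U x := by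
    intro x hx
    have hv : P s (U x - P s (U x)) = 0 := by rw [map_sub, hidem, sub_self]
    have h2 := (hUP.inner_eq_zero hx hv).2
    have h3 : inner ℂ (U x - P s (U x)) (P s (U x)) = 0 := by
      rw [← hP.inner_apply_left, hv, inner_zero_left]
    have h4 : inner ℂ (U x - P s (U x)) (U x - P s (U x)) = 0 := by
      rw [inner_sub_right, h2, h3, sub_zero]
    exact (sub_eq_zero.1 (inner_self_eq_zero.1 h4)).symm
  have h2 : ∀ y, P s y = 0 → P s (U y) = 0 := by
    intro y hy
    have h3 := (hUP.inner_eq_zero (hidem (U y)) hy).1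
    exact inner_self_eq_zero.1 (by rw [← hP.inner_apply_left, hidem, h3])
  have h3 := h1 (P s z) (hidem z)
  have h4 := h2 (z - P s z) (by rw [map_sub, hidem, sub_self])
  rw [map_sub, map_sub, h3, sub_eq_zero] at h4
  exact h4

lemma pow_apply_comm (n : ℕ) (s : ℝ) (z : K) : P s ((U ^ n) z) = (U ^ n) (P s z) := by
  induction n with
  | zero => rfl
  | succ n ih => rw [pow_succ', Module.End.mul_apply, hUP.apply_comm, ih, Module.End.mul_apply]

/-- On the range of `Π_b - Π_a` the isometry `U` is close to the multiplication by `e^{ib}`. -/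
lemma norm_apply_sub_sq_le (hU : ∀ z, ‖U z‖ = ‖z‖) {a b : ℝ} {z : K}
    (ha : P a z = 0) (hb : P b z = z) :
    ‖U z - Complex.exp (Complex.I * b) • z‖ ^ 2 ≤ 2 * (b - a) * ‖z‖ ^ 2 := by
  have hP := hUP.isResolution
  have := hP.isFiniteMeasure z
  have hreal : (hP.stieltjes z).measure.real univ = ‖z‖ ^ 2 := by
    rw [measureReal_def, hP.measure_univ, ENNReal.toReal_ofReal (sq_nonneg _)]
  have hdiff : ‖inner ℂ z (U z) - Complex.exp (Complex.I * b) * (‖z‖ ^ 2 : ℝ)‖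
      ≤ (b - a) * ‖z‖ ^ 2 := by
    have hi : Integrable (fun θ : ℝ => Complex.exp (Complex.I * θ)) (hP.stieltjes z).measure := by
      simpa using integrable_exp_I_mul (hP.stieltjes z).measure 1
    have h1 : inner ℂ z (U z) - Complex.exp (Complex.I * b) * (‖z‖ ^ 2 : ℝ)
        = ∫ θ : ℝ, (Complex.exp (Complex.I * θ) - Complex.exp (Complex.I * b))
          ∂(hP.stieltjes z).measure := by
      rw [integral_sub hi (integrable_const _), ← hUP.integral_eq, integral_const, hreal,
        Complex.real_smul, mul_comm]
    rw [h1, ← hreal]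
    refine norm_integral_le_of_norm_le_const ?_
    filter_upwards [hP.ae_mem_Ioc ha hb] with θ hθ
    refine (norm_exp_I_mul_sub_le θ b).trans ?_
    rw [abs_of_nonpos (by linarith [hθ.2])]
    linarith [hθ.1]
  have h2 : ‖U z - Complex.exp (Complex.I * b) • z‖ ^ 2
      = 2 * (Complex.exp (-(Complex.I * b)) *
        (Complex.exp (Complex.I * b) * (‖z‖ ^ 2 : ℝ) - inner ℂ z (U z))).re := by
    rw [_root_.norm_sub_sq (𝕜 := ℂ), hU, norm_smul, norm_exp_I_mul, one_mul, ← inner_conj_symm,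
      inner_smul_left, mul_sub, ← mul_assoc, ← Complex.exp_add, neg_add_cancel, Complex.exp_zero,
      one_mul, Complex.sub_re, Complex.ofReal_re, RCLike.conj_re, ← Complex.exp_conj]
    simp only [map_mul, Complex.conj_I, Complex.conj_ofReal, neg_mul, RCLike.re_to_complex]
    ring
  rw [h2]
  have h3 := Complex.re_le_norm (Complex.exp (-(Complex.I * b)) *
        (Complex.exp (Complex.I * b) * (‖z‖ ^ 2 : ℝ) - inner ℂ z (U z)))
  have h4 : ‖Complex.exp (-(Complex.I * b))‖ = 1 := by
    have := norm_exp_I_mul (-b)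
    rwa [Complex.ofReal_neg, mul_neg] at this
  rw [norm_mul, h4, one_mul, norm_sub_rev] at h3
  linarith

/-- The powers of `U` are the Fourier coefficients of the spectral measures. The difference of the
two sides, with `z` replaced by `Π_θ z`, is a function of `θ` whose increments over a partition are
small compared to those of `θ ↦ ‖Π_θ z‖²`. -/
lemma inner_pow_apply (hU : ∀ z, ‖U z‖ = ‖z‖) (n : ℕ) (z : K) : inner ℂ z ((U ^ n) z)
    = ∫ θ : ℝ, Complex.exp (Complex.I * (n * θ : ℝ)) ∂(hUP.isResolution.stieltjes z).measure := by
  have hP := hUP.isResolution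
  have := hP.isFiniteMeasure z
  set ν := (hP.stieltjes z).measure with hν
  set φ : ℝ → ℂ := fun θ => Complex.exp (Complex.I * (n * θ : ℝ)) with hφ
  have hi : Integrable φ ν := integrable_exp_I_mul ν n
  let G : ℝ → ℂ := fun θ => inner ℂ z ((U ^ n) (P θ z)) - ∫ s in Ioc 0 θ, φ s ∂ν
  -- Both terms of `G b - G a` are approximated by `e^{inb} ‖v‖²`, where `v = Π_b z - Π_a z`.
  have hincr : ∀ a b : ℝ, 0 ≤ a → a ≤ b → ‖G b - G a‖
      ≤ (n * √(2 * (b - a)) + n * (b - a)) * (‖P b z‖ ^ 2 - ‖P a z‖ ^ 2) := by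
    intro a b ha hab
    set v := P b z - P a z with hv
    have hva : P a v = 0 := by
      rw [hv, map_sub, hP.apply_apply_of_le hab, hP.apply_apply_of_le le_rfl, sub_self]
    have hvb : P b v = v := by
      rw [hv, map_sub, hP.apply_apply_of_le le_rfl, hP.apply_apply_of_ge hab]
    have hvn : ‖v‖ ^ 2 = ‖P b z‖ ^ 2 - ‖P a z‖ ^ 2 := hP.norm_sub_sq hab z
    have hG : G b - G a = inner ℂ v ((U ^ n) v) - ∫ s in Ioc a b, φ s ∂ν := by
      have h1 : ∫ s in Ioc 0 b, φ s ∂ν = (∫ s in Ioc 0 a, φ s ∂ν) + ∫ s in Ioc a b, φ s ∂ν := by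
        rw [← Ioc_union_Ioc_eq_Ioc ha hab, setIntegral_union (Ioc_disjoint_Ioc_of_le le_rfl)
          measurableSet_Ioc hi.integrableOn hi.integrableOn]
      have h2 : inner ℂ v ((U ^ n) v) = inner ℂ z ((U ^ n) v) := by
        conv_lhs => rw [hv, inner_sub_left, hP.inner_apply_left, hP.inner_apply_left,
          hUP.pow_apply_comm, hUP.pow_apply_comm, hva, hvb, map_zero, inner_zero_right, sub_zero]
      rw [h2, hv, map_sub, inner_sub_right]
      simp only [G, h1]
      ring
    have hmass : ν.real (Ioc a b) = ‖v‖ ^ 2 := by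
      rw [measureReal_def, hν, hP.measure_Ioc, ← hvn, ENNReal.toReal_ofReal (sq_nonneg _)]
    set c := Complex.exp (Complex.I * b) with hc
    have hcn : c ^ n = Complex.exp (Complex.I * (n * b : ℝ)) := by
      rw [hc, ← Complex.exp_nat_mul]
      congr 1
      push_cast
      ring
    have h1 : ‖inner ℂ v ((U ^ n) v) - c ^ n * (‖v‖ ^ 2 : ℝ)‖ ≤ n * √(2 * (b - a)) * ‖v‖ ^ 2 := by
      have h2 : inner ℂ v ((U ^ n) v) - c ^ n * (‖v‖ ^ 2 : ℝ)
          = inner ℂ v ((U ^ n) v - c ^ n • v) := by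
        rw [inner_sub_right, inner_smul_right, inner_self_eq_norm_sq_to_K]
        norm_cast
      have h3 : ‖U v - c • v‖ ≤ √(2 * (b - a)) * ‖v‖ := by
        have h4 := Real.sqrt_le_sqrt (hUP.norm_apply_sub_sq_le hU hva hvb)
        rwa [Real.sqrt_sq (norm_nonneg _), Real.sqrt_mul' _ (sq_nonneg _),
          Real.sqrt_sq (norm_nonneg _)] at h4
      rw [h2]
      calc _ ≤ ‖v‖ * ‖(U ^ n) v - c ^ n • v‖ := norm_inner_le_norm _ _
        _ ≤ ‖v‖ * (n * (√(2 * (b - a)) * ‖v‖)) := by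
          gcongr
          refine (norm_pow_apply_sub_le hU (norm_exp_I_mul b) v n).trans ?_
          gcongr
        _ = n * √(2 * (b - a)) * ‖v‖ ^ 2 := by ring
    have h2 : ‖(∫ s in Ioc a b, φ s ∂ν) - c ^ n * (‖v‖ ^ 2 : ℝ)‖ ≤ n * (b - a) * ‖v‖ ^ 2 := by
      have h3 : (∫ s in Ioc a b, φ s ∂ν) - c ^ n * (‖v‖ ^ 2 : ℝ)
          = ∫ s in Ioc a b, (φ s - c ^ n) ∂ν := by
        rw [integral_sub hi.integrableOn (integrable_const _), setIntegral_const, hmass,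
          Complex.real_smul, mul_comm]
      rw [h3, ← hmass]
      refine norm_setIntegral_le_of_norm_le_const (measure_lt_top _ _) fun s hs => ?_
      rw [hcn]
      refine (norm_exp_I_mul_sub_le _ _).trans ?_
      rw [← mul_sub, abs_mul, Nat.abs_cast, abs_of_nonpos (by linarith [hs.2])]
      gcongr
      linarith [hs.1]
    rw [hG, ← hvn]
    calc _ = ‖(inner ℂ v ((U ^ n) v) - c ^ n * (‖v‖ ^ 2 : ℝ))
          - ((∫ s in Ioc a b, φ s ∂ν) - c ^ n * (‖v‖ ^ 2 : ℝ))‖ := by congr 1; ring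
      _ ≤ _ := norm_sub_le _ _
      _ ≤ _ := by linarith
  have h2π : 0 ≤ 2 * Real.pi := by positivity
  -- The increments of `G` over `m + 1` intervals of equal length.
  have htotal : ∀ m : ℕ, ‖G (2 * Real.pi) - G 0‖
      ≤ (n * √(2 * (2 * Real.pi / ((m : ℝ) + 1))) + n * (2 * Real.pi / ((m : ℝ) + 1)))
        * ‖z‖ ^ 2 := by
    intro m
    set d : ℝ := 2 * Real.pi / ((m : ℝ) + 1) with hd
    have hd0 : 0 ≤ d := by positivity
    have hend : ((m + 1 : ℕ) : ℝ) * d = 2 * Real.pi := by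
      rw [hd]
      push_cast
      field_simp
    have h1 := Finset.sum_range_sub (fun j : ℕ => G (j * d)) (m + 1)
    have h2 := Finset.sum_range_sub (fun j : ℕ => ‖P (j * d) z‖ ^ 2) (m + 1)
    simp only [hend, Nat.cast_zero, zero_mul] at h1 h2
    have h3 : ‖P (2 * Real.pi) z‖ ^ 2 - ‖P 0 z‖ ^ 2 = ‖z‖ ^ 2 := by
      rw [hP.eq_one _ le_rfl, hP.eq_zero _ le_rfl]
      simp
    rw [← h1, ← h3, ← h2, Finset.mul_sum]
    refine norm_sum_le_of_le _ fun j _ => ?_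
    have h4 := hincr (j * d) ((j + 1 : ℕ) * d) (by positivity)
      (by push_cast; nlinarith)
    have h5 : ((j + 1 : ℕ) : ℝ) * d - j * d = d := by push_cast; ring
    rwa [h5] at h4
  have hlim : Tendsto (fun m : ℕ => (n * √(2 * (2 * Real.pi / ((m : ℝ) + 1)))
      + n * (2 * Real.pi / ((m : ℝ) + 1))) * ‖z‖ ^ 2) atTop (𝓝 0) := by
    have h1 : Tendsto (fun m : ℕ => 2 * Real.pi / ((m : ℝ) + 1)) atTop (𝓝 0) := by
      have := tendsto_one_div_add_atTop_nhds_zero_nat.const_mul (2 * Real.pi) (α := ℕ) (M := ℝ)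
      simpa [div_eq_mul_inv] using this
    have h2 : Continuous fun d : ℝ => (n * √(2 * d) + n * d) * ‖z‖ ^ 2 := by fun_prop
    have h3 := (h2.tendsto 0).comp h1
    simp only [mul_zero, Real.sqrt_zero, add_zero, zero_mul] at h3
    exact h3
  have hzero : G (2 * Real.pi) - G 0 = 0 := by
    refine norm_le_zero_iff.1 (ge_of_tendsto' hlim htotal)
  have hsupp : ∫ s in Ioc 0 (2 * Real.pi), φ s ∂ν = ∫ s, φ s ∂ν := by
    rw [Measure.restrict_eq_self_of_ae_mem]
    exact hP.ae_mem_Ioc (by rw [hP.eq_zero _ le_rfl]; rfl) (by rw [hP.eq_one _ le_rfl]; rfl)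
  simp only [G, hsupp, hP.eq_one _ le_rfl, hP.eq_zero _ le_rfl] at hzero
  simpa [sub_eq_zero] using hzero

end IsSpectralResolution

end

/-! ### Wiener's lemma, atoms and eigenvectors -/

lemma norm_sum_exp_le {x : ℝ} (hx : Complex.exp (Complex.I * x) ≠ 1) (N : ℕ) :
    ‖∑ k ∈ Finset.range N, Complex.exp (Complex.I * (k * x : ℝ))‖
      ≤ 2 / ‖Complex.exp (Complex.I * x) - 1‖ := by
  have h1 : ∀ k : ℕ, Complex.exp (Complex.I * (k * x : ℝ)) = Complex.exp (Complex.I * x) ^ k := by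
    intro k
    rw [← Complex.exp_nat_mul]
    congr 1
    push_cast
    ring
  simp only [h1]
  rw [geom_sum_eq hx, norm_div]
  gcongr
  refine (norm_sub_le _ _).trans ?_
  rw [norm_pow, norm_exp_I_mul, one_pow, norm_one]
  norm_num

/-- Wiener's lemma: the Fourier coefficients of an atomless finite measure are null in mean. -/
lemma isNullInMean_fourier (ν : Measure ℝ) [IsFiniteMeasure ν] [NullSingletonClass ν] :
    IsNullInMean fun n : ℕ => ∫ θ : ℝ, Complex.exp (Complex.I * (n * θ : ℝ)) ∂ν := by
  -- The diagonal modulo `2π` has countable sections, hence is a null set of `ν × ν`.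
  have hexp : ∀ᵐ p ∂(ν.prod ν), Complex.exp (Complex.I * (p.1 - p.2 : ℝ)) ≠ 1 := by
    have hmeas : MeasurableSet {p : ℝ × ℝ | Complex.exp (Complex.I * (p.1 - p.2 : ℝ)) = 1} :=
      (isClosed_eq (by fun_prop) continuous_const).measurableSet
    rw [ae_iff]
    simp only [not_not]
    rw [Measure.measure_prod_null hmeas]
    refine Eventually.of_forall fun x => ?_
    refine Countable.measure_zero ((countable_range fun k : ℤ => x - k * (2 * Real.pi)).mono ?_) ν
    intro y hy
    obtain ⟨k, hk⟩ := Complex.exp_eq_one_iff.1 hy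
    refine ⟨k, ?_⟩
    have h1 : ((x - y : ℝ) : ℂ) = ((k * (2 * Real.pi) : ℝ) : ℂ) := by
      refine mul_left_cancel₀ Complex.I_ne_zero (hk.trans ?_)
      push_cast
      ring
    have h2 := Complex.ofReal_injective h1
    simp only
    linarith
  have hcont : ∀ k : ℕ, Continuous fun p : ℝ × ℝ =>
      Complex.exp (Complex.I * (k * (p.1 - p.2) : ℝ)) := fun k => by fun_prop
  have hint : ∀ k : ℕ, Integrable (fun p : ℝ × ℝ =>
      Complex.exp (Complex.I * (k * (p.1 - p.2) : ℝ))) (ν.prod ν) := fun k =>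
    Integrable.of_bound (C := 1) (hcont k).aestronglyMeasurable
      (Eventually.of_forall fun p => (norm_exp_I_mul _).le)
  have hsq : ∀ k : ℕ, ((‖∫ θ : ℝ, Complex.exp (Complex.I * (k * θ : ℝ)) ∂ν‖ ^ 2 : ℝ) : ℂ)
      = ∫ p : ℝ × ℝ, Complex.exp (Complex.I * (k * (p.1 - p.2) : ℝ)) ∂(ν.prod ν) := by
    intro k
    have h1 : ∀ p : ℝ × ℝ, Complex.exp (Complex.I * (k * (p.1 - p.2) : ℝ))
        = Complex.exp (Complex.I * (k * p.1 : ℝ)) *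
          (starRingEnd ℂ) (Complex.exp (Complex.I * (k * p.2 : ℝ))) := by
      intro p
      rw [← Complex.exp_conj, ← Complex.exp_add, map_mul, Complex.conj_I, Complex.conj_ofReal]
      congr 1
      push_cast
      ring
    simp only [h1]
    rw [integral_prod_mul (fun x : ℝ => Complex.exp (Complex.I * (k * x : ℝ)))
      (fun y : ℝ => (starRingEnd ℂ) (Complex.exp (Complex.I * (k * y : ℝ)))), integral_conj,
      Complex.mul_conj, Complex.normSq_eq_norm_sq]
  -- Off this set the means of the geometric series `∑ e^{ik(x - y)}` tend to zero.
  have hlim : Tendsto (fun N : ℕ => ∫ p : ℝ × ℝ, ((N : ℝ)⁻¹ : ℂ) * ∑ k ∈ Finset.range N,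
      Complex.exp (Complex.I * (k * (p.1 - p.2) : ℝ)) ∂(ν.prod ν)) atTop
      (𝓝 (∫ _ : ℝ × ℝ, (0 : ℂ) ∂(ν.prod ν))) := by
    refine tendsto_integral_of_dominated_convergence (fun _ => 1) (fun N => ?_)
      (integrable_const 1) (fun N => Eventually.of_forall fun p => ?_) ?_
    · exact (continuous_const.mul
        (continuous_finsetSum _ fun k _ => hcont k)).aestronglyMeasurable
    · rw [norm_mul, norm_inv, Complex.norm_real, Real.norm_natCast]
      calc (N : ℝ)⁻¹ * ‖∑ k ∈ Finset.range N, Complex.exp (Complex.I * (k * (p.1 - p.2) : ℝ))‖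
          ≤ (N : ℝ)⁻¹ * ∑ k ∈ Finset.range N, 1 := by
            gcongr
            exact norm_sum_le_of_le _ fun k _ => (norm_exp_I_mul _).le
        _ ≤ 1 := by
            rw [Finset.sum_const, Finset.card_range, nsmul_eq_mul, mul_one]
            exact inv_mul_le_one
    · filter_upwards [hexp] with p hp
      rw [tendsto_zero_iff_norm_tendsto_zero]
      have h1 : Tendsto (fun N : ℕ => (N : ℝ)⁻¹ *
          (2 / ‖Complex.exp (Complex.I * (p.1 - p.2 : ℝ)) - 1‖)) atTop (𝓝 0) := by
        simpa using tendsto_inv_atTop_nhds_zero_nat.mul_const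
          (2 / ‖Complex.exp (Complex.I * (p.1 - p.2 : ℝ)) - 1‖)
      refine squeeze_zero (fun N => norm_nonneg _) (fun N => ?_) h1
      rw [norm_mul, norm_inv, Complex.norm_real, Real.norm_natCast]
      gcongr
      exact norm_sum_exp_le hp N
  refine IsNullInMean.of_sq ?_
  rw [integral_zero] at hlim
  refine ((Complex.continuous_re.tendsto 0).comp hlim).congr fun N => ?_
  rw [Function.comp_apply, integral_const_mul, integral_finsetSum _ fun k _ => hint k]
  simp only [← hsq]
  rw [← Complex.ofReal_sum, ← Complex.ofReal_inv, ← Complex.ofReal_mul, Complex.ofReal_re]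

section

variable {K : Type*} [NormedAddCommGroup K] [InnerProductSpace ℂ K] {P : ℝ → K →L[ℂ] K}
  {U : K →ₗ[ℂ] K}

/-- If `θ ↦ (Π_θ z, z)` is continuous on `[0, 2π]`, the spectral measure of `z` has no atoms: the
function vanishes on `(-∞, 0]` and is constant on `[2π, ∞)`. -/
lemma IsResolutionOfIdentity.nullSingletonClass (hP : IsResolutionOfIdentity P) {z : K}
    (hz : ContinuousOn (fun θ => inner ℂ z (P θ z)) (Icc 0 (2 * Real.pi))) :
    NullSingletonClass (hP.stieltjes z).measure := by
  refine ⟨fun θ => ?_⟩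
  rw [StieltjesFunction.measure_singleton]
  suffices h : Tendsto (hP.stieltjes z) (𝓝[<] θ) (𝓝 (hP.stieltjes z θ)) by
    rw [leftLim_eq_of_tendsto h]
    simp
  rcases le_or_gt θ 0 with h0 | h0
  · refine tendsto_const_nhds.congr' ?_
    filter_upwards [self_mem_nhdsWithin] with s hs
    rw [hP.stieltjes_apply, hP.stieltjes_apply, hP.eq_zero _ h0,
      hP.eq_zero s ((mem_Iio.1 hs).le.trans h0)]
  rcases le_or_gt θ (2 * Real.pi) with h1 | h1
  · have h2 : Tendsto (fun s => inner ℂ z (P s z)) (𝓝[<] θ) (𝓝 (inner ℂ z (P θ z))) :=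
      (hz θ ⟨h0.le, h1⟩).mono_left
        (nhdsWithin_le_iff.2 (mem_of_superset (Ioo_mem_nhdsLT h0) fun s hs =>
          ⟨hs.1.le, hs.2.le.trans h1⟩))
    have h3 : ∀ s, hP.stieltjes z s = (inner ℂ z (P s z)).re := fun s => by
      rw [← hP.inner_apply_left]
      rfl
    rw [h3 θ]
    refine Tendsto.congr (fun s => (h3 s).symm) ?_
    exact (Complex.continuous_re.tendsto _).comp h2
  · refine tendsto_const_nhds.congr' ?_
    filter_upwards [Ioo_mem_nhdsLT h1] with s hs
    rw [hP.stieltjes_apply, hP.stieltjes_apply, hP.eq_one _ h1.le, hP.eq_one s hs.1.le]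

/-- If the spectral measures have no atoms, the matrix coefficients of `Uⁿ` are null in mean. -/
lemma IsSpectralResolution.isNullInMean_inner (hUP : IsSpectralResolution U P)
    (hU : ∀ z, ‖U z‖ = ‖z‖)
    (hP : ∀ z, NullSingletonClass (hUP.isResolution.stieltjes z).measure) (x y : K) :
    IsNullInMean fun n : ℕ => inner ℂ x ((U ^ n) y) := by
  have hquad : ∀ z, IsNullInMean fun n : ℕ => inner ℂ z ((U ^ n) z) := by
    intro z
    have := hUP.isResolution.isFiniteMeasure z
    have := hP z
    simp only [hUP.inner_pow_apply hU]
    exact isNullInMean_fourier _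
  -- Polarization.
  have hpol : ∀ n : ℕ, 4 * inner ℂ x ((U ^ n) y) =
      (inner ℂ (x + y) ((U ^ n) (x + y)) + -inner ℂ (x - y) ((U ^ n) (x - y)))
        + (-Complex.I * inner ℂ (x + Complex.I • y) ((U ^ n) (x + Complex.I • y))
        + Complex.I * inner ℂ (x - Complex.I • y) ((U ^ n) (x - Complex.I • y))) := by
    intro n
    simp only [map_add, map_sub, map_smul, inner_add_left, inner_add_right, inner_sub_left,
      inner_sub_right, inner_smul_left, inner_smul_right, Complex.conj_I]
    ring_nf
    rw [Complex.I_sq]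
    ring
  have hsum := ((hquad (x + y)).add ((hquad (x - y)).mono (a := fun n =>
      -inner ℂ (x - y) ((U ^ n) (x - y))) 1 fun n => by rw [norm_neg, one_mul])).add
    (((hquad (x + Complex.I • y)).mono (a := fun n =>
      -Complex.I * inner ℂ (x + Complex.I • y) ((U ^ n) (x + Complex.I • y))) 1 fun n => by
        rw [norm_mul, norm_neg, Complex.norm_I]).add
    ((hquad (x - Complex.I • y)).mono (a := fun n =>
      Complex.I * inner ℂ (x - Complex.I • y) ((U ^ n) (x - Complex.I • y))) 1 fun n => by
        rw [norm_mul, Complex.norm_I]))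
  refine hsum.mono 1 fun n => ?_
  rw [← hpol, norm_mul, one_mul]
  norm_num
  linarith [norm_nonneg (inner ℂ x ((U ^ n) y))]

/-- If an isometry has no eigenvectors, its resolution of the identity is strongly continuous: a
jump `Π_θ z - Π_{θ-} z` would be an eigenvector for the eigenvalue `e^{iθ}`. -/
lemma IsSpectralResolution.continuous_apply [CompleteSpace K] (hUP : IsSpectralResolution U P)
    (hU : ∀ z, ‖U z‖ = ‖z‖) (hev : ∀ (c : ℂ) (v : K), ‖c‖ = 1 → U v = c • v → v = 0) (z : K) :
    Continuous fun θ => P θ z := by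
  have hP := hUP.isResolution
  refine continuous_iff_continuousAt.2 fun θ => ?_
  suffices h : Tendsto (fun s => P s z) (𝓝[<] θ) (𝓝 (P θ z)) from
    continuousAt_iff_continuous_left_right.2
      ⟨continuousWithinAt_Iio_iff_Iic.1 h, hP.right_continuous z θ⟩
  -- The left limit exists because `‖Π_t z - Π_s z‖²` is an increment of the monotone function
  -- `θ ↦ ‖Π_θ z‖²`.
  have hcauchy : Cauchy (map (fun s => P s z) (𝓝[<] θ)) := by
    rw [cauchy_map_iff]
    refine ⟨inferInstance, tendsto_uniformity_iff_dist_tendsto_zero.2 ?_⟩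
    have hF := (hP.stieltjes z).mono.tendsto_leftLim θ
    have h1 : Tendsto (fun p : ℝ × ℝ => √|hP.stieltjes z p.1 - hP.stieltjes z p.2|)
        (𝓝[<] θ ×ˢ 𝓝[<] θ) (𝓝 0) := by
      have h2 := (((hF.comp tendsto_fst).sub (hF.comp tendsto_snd)).abs.sqrt :
        Tendsto _ (𝓝[<] θ ×ˢ 𝓝[<] θ) _)
      rw [sub_self, abs_zero, Real.sqrt_zero] at h2
      exact h2
    refine h1.congr fun p => ?_
    rw [hP.stieltjes_apply, hP.stieltjes_apply, dist_eq_norm]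
    rcases le_total p.1 p.2 with h | h
    · rw [abs_sub_comm, ← hP.norm_sub_sq h, abs_of_nonneg (sq_nonneg _),
        Real.sqrt_sq (norm_nonneg _), norm_sub_rev]
    · rw [← hP.norm_sub_sq h, abs_of_nonneg (sq_nonneg _), Real.sqrt_sq (norm_nonneg _)]
  obtain ⟨y, hy⟩ := CompleteSpace.complete hcauchy
  have hy : Tendsto (fun s => P s z) (𝓝[<] θ) (𝓝 y) := hy
  have hPy : ∀ s < θ, P s y = P s z := by
    intro s hs
    refine tendsto_nhds_unique (((P s).continuous.tendsto y).comp hy)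
      (tendsto_const_nhds.congr' ?_)
    filter_upwards [Ioo_mem_nhdsLT hs] with t ht
    exact (hP.apply_apply_of_le ht.1.le z).symm
  have hPθ : P θ y = y := by
    refine tendsto_nhds_unique (((P θ).continuous.tendsto y).comp hy) (hy.congr' ?_)
    filter_upwards [self_mem_nhdsWithin] with t ht
    exact (hP.apply_apply_of_ge (mem_Iio.1 ht).le z).symm
  have hb : P θ (P θ z - y) = P θ z - y := by
    rw [map_sub, hPθ, hP.apply_apply_of_le le_rfl]
  have ha : ∀ s < θ, P s (P θ z - y) = 0 := fun s hs => by
    rw [map_sub, hPy s hs, hP.apply_apply_of_le hs.le, sub_self]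
  have hlim : Tendsto (fun s => 2 * (θ - s) * ‖P θ z - y‖ ^ 2) (𝓝[<] θ) (𝓝 0) := by
    have h1 : Continuous fun s => 2 * (θ - s) * ‖P θ z - y‖ ^ 2 := by fun_prop
    have h2 := (h1.tendsto θ).mono_left (nhdsWithin_le_nhds (s := Iio θ))
    simpa using h2
  have h1 : ‖U (P θ z - y) - Complex.exp (Complex.I * θ) • (P θ z - y)‖ ^ 2 ≤ 0 := by
    refine ge_of_tendsto hlim ?_
    filter_upwards [self_mem_nhdsWithin] with s hs
    exact hUP.norm_apply_sub_sq_le hU (ha s hs) hb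
  have h2 := hev _ _ (norm_exp_I_mul θ)
    (sub_eq_zero.1 (norm_eq_zero.1 (pow_eq_zero_iff two_ne_zero |>.1
      (le_antisymm h1 (sq_nonneg _)))))
  rw [← sub_eq_zero.1 h2] at hy
  exact hy

end

/-! ### Complexifications of Hilbert spaces -/

namespace Complexification

variable {H : Type*} [NormedAddCommGroup H] [InnerProductSpace ℝ H]

lemma norm_sq (z : Complexification H) : ‖z‖ ^ 2 = ‖z.re‖ ^ 2 + ‖z.im‖ ^ 2 := by
  rw [norm_sq_eq_re_inner (𝕜 := ℂ) z, ← real_inner_self_eq_norm_sq, ← real_inner_self_eq_norm_sq]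
  rfl

lemma norm_re_le (z : Complexification H) : ‖z.re‖ ≤ ‖z‖ :=
  (sq_le_sq₀ (norm_nonneg _) (norm_nonneg _)).1
    (by rw [norm_sq]; exact le_add_of_nonneg_right (sq_nonneg _))

lemma norm_im_le (z : Complexification H) : ‖z.im‖ ≤ ‖z‖ :=
  (sq_le_sq₀ (norm_nonneg _) (norm_nonneg _)).1
    (by rw [norm_sq]; exact le_add_of_nonneg_left (sq_nonneg _))

instance [CompleteSpace H] : CompleteSpace (Complexification H) := by
  refine Metric.complete_of_cauchySeq_tendsto fun u hu => ?_
  have hre : LipschitzWith 1 (re : Complexification H → H) := LipschitzWith.of_dist_le_mul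
    fun z z' => by
      rw [dist_eq_norm, dist_eq_norm, NNReal.coe_one, one_mul]
      exact norm_re_le (z - z')
  have him : LipschitzWith 1 (im : Complexification H → H) := LipschitzWith.of_dist_le_mul
    fun z z' => by
      rw [dist_eq_norm, dist_eq_norm, NNReal.coe_one, one_mul]
      exact norm_im_le (z - z')
  obtain ⟨a, ha⟩ := cauchySeq_tendsto_of_complete (hre.uniformContinuous.comp_cauchySeq hu)
  obtain ⟨b, hb⟩ := cauchySeq_tendsto_of_complete (him.uniformContinuous.comp_cauchySeq hu)
  refine ⟨⟨a, b⟩, tendsto_iff_norm_sub_tendsto_zero.2 ?_⟩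
  have h1 := (((tendsto_iff_norm_sub_tendsto_zero.1 ha).pow 2).add
    ((tendsto_iff_norm_sub_tendsto_zero.1 hb).pow 2)).sqrt
  simp only [ne_eq, OfNat.ofNat_ne_zero, not_false_eq_true, zero_pow, add_zero,
    Real.sqrt_zero] at h1
  refine h1.congr fun n => ?_
  rw [← Real.sqrt_sq (norm_nonneg (u n - _)), norm_sq]
  rfl

lemma eq_ofReal_add (z : Complexification H) : z = ofReal z.re + Complex.I • ofReal z.im := by
  simp [ofReal, smul_def, add_def]

lemma norm_mapLinear (R : H ≃ₗᵢ[ℝ] H) (z : Complexification H) :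
    ‖mapLinear R.toLinearEquiv.toLinearMap z‖ = ‖z‖ := by
  rw [← sq_eq_sq₀ (norm_nonneg _) (norm_nonneg _), norm_sq, norm_sq]
  congr 2
  · exact R.norm_map z.re
  · exact R.norm_map z.im

lemma mapLinear_pow_ofReal (R : H →ₗ[ℝ] H) (n : ℕ) (h : H) :
    (mapLinear R ^ n) (ofReal h) = ofReal (R^[n] h) := by
  induction n with
  | zero => rfl
  | succ n ih =>
    rw [pow_succ', Module.End.mul_apply, ih, Function.iterate_succ_apply']
    exact Complexification.ext rfl (map_zero R)

lemma re_inner_ofReal (h k : H) : (inner ℂ (ofReal h) (ofReal k)).re = inner ℝ h k := by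
  change inner ℝ h k + inner ℝ 0 0 = inner ℝ h k
  rw [inner_zero_left, add_zero]

/-- Continuity of the real matrix coefficients of `(Π_θ)` implies that of the complex quadratic
forms. -/
lemma continuousOn_inner_self {P : ℝ → Complexification H →L[ℂ] Complexification H} {S : Set ℝ}
    (hP : ∀ h k : H, ContinuousOn (fun θ => inner ℂ (ofReal k) (P θ (ofReal h))) S)
    (z : Complexification H) : ContinuousOn (fun θ => inner ℂ z (P θ z)) S := by
  rw [eq_ofReal_add z]
  simp only [map_add, map_smul, inner_add_left, inner_add_right, inner_smul_left, inner_smul_right]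
  exact (((hP _ _).add ((hP _ _).const_mul _))).add
    (continuousOn_const.mul ((hP _ _).add (continuousOn_const.mul (hP _ _))))

end Complexification

/-! ### Ergodicity and the spectrum of `R` -/

section

variable {μ : Measure WienerSpace} {hμ : IsWienerMeasure μ}

/-- A nonzero Wiener integral is not essentially bounded, its law being equivalent to the Lebesgue
measure. -/
lemma eq_zero_of_ae_wienerIntegral_sq_le {h : CameronMartin} {c : ℝ}
    (hc : ∀ᵐ w ∂μ, (wienerIntegral hμ h w) ^ 2 ≤ c) : h = 0 := by
  by_contra hne
  have hopen : IsOpen {x : ℝ | c < x ^ 2} := isOpen_lt continuous_const (by fun_prop)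
  have hpos : (‖h‖ ^ 2).toNNReal ≠ 0 := (Real.toNNReal_pos.2 (by positivity)).ne'
  have h1 : gaussianReal 0 (‖h‖ ^ 2).toNNReal {x | c < x ^ 2} = 0 := by
    rw [← map_wienerIntegral hμ h, Measure.map_apply_of_aemeasurable
      (Lp.aestronglyMeasurable _).aemeasurable hopen.measurableSet]
    simp only [ae_iff, not_le] at hc
    exact hc
  have h2 := gaussianReal_absolutelyContinuous' 0 hpos h1
  refine (hopen.measure_pos volume ⟨|c| + 1, ?_⟩).ne' h2
  change c < (|c| + 1) ^ 2
  nlinarith [le_abs_self c, abs_nonneg c]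

/-- If the rotation is ergodic, `R` has no eigenvectors: for a unimodular eigenvalue with
eigenvector `h + ik`, the function `(δh)² + (δk)²` is invariant, hence constant, so that the
Gaussian variables `δh` and `δk` are bounded. -/
lemma IsTransport.eq_zero_of_mapLinear_eq_smul {V : CameronMartin →ₗᵢ[ℝ] CameronMartin}
    {T : WienerSpace → WienerSpace} (hT : IsTransport hμ V T) (hE : Ergodic T μ) {c : ℂ}
    {v : Complexification CameronMartin} (hc : ‖c‖ = 1)
    (hv : Complexification.mapLinear V.toLinearMap v = c • v) : v = 0 := by
  let f : WienerSpace → ℝ := fun w =>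
    (wienerIntegral hμ v.re w) ^ 2 + (wienerIntegral hμ v.im w) ^ 2
  have hre : V v.re = c.re • v.re - c.im • v.im := congrArg Complexification.re hv
  have him : V v.im = c.re • v.im + c.im • v.re := congrArg Complexification.im hv
  have hc2 : c.re ^ 2 + c.im ^ 2 = 1 := by
    rw [← one_pow 2, ← hc, ← Complex.normSq_eq_norm_sq, Complex.normSq_apply]
    ring
  have hlin : ∀ (a b : ℝ) (h k : CameronMartin), wienerIntegral hμ (a • h + b • k)
      =ᵐ[μ] fun w => a * wienerIntegral hμ h w + b * wienerIntegral hμ k w := by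
    intro a b h k
    rw [map_add, map_smul, map_smul]
    filter_upwards [Lp.coeFn_add (a • wienerIntegral hμ h) (b • wienerIntegral hμ k),
      Lp.coeFn_smul a (wienerIntegral hμ h), Lp.coeFn_smul b (wienerIntegral hμ k)] with w h1 h2 h3
    rw [h1, Pi.add_apply, h2, h3]
    rfl
  have hinv : f ∘ T =ᵐ[μ] f := by
    have h1 := hT.wienerIntegral_comp v.re
    have h2 := hT.wienerIntegral_comp v.im
    rw [hre, sub_eq_add_neg, ← neg_smul] at h1
    rw [him] at h2
    filter_upwards [h1, h2, hlin c.re (-c.im) v.re v.im, hlin c.re c.im v.im v.re]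
      with w h1 h2 h3 h4
    simp only [f, Function.comp_apply]
    rw [h1, h2, h3, h4]
    linear_combination
      ((wienerIntegral hμ v.re w) ^ 2 + (wienerIntegral hμ v.im w) ^ 2) * hc2
  obtain ⟨d, hd⟩ := hE.quasiErgodic.ae_eq_const_of_ae_eq_comp₀
    (((Lp.aestronglyMeasurable _).pow 2).add
      ((Lp.aestronglyMeasurable _).pow 2)).aemeasurable.nullMeasurable hinv
  refine Complexification.ext (eq_zero_of_ae_wienerIntegral_sq_le (hμ := hμ) (c := d) ?_)
    (eq_zero_of_ae_wienerIntegral_sq_le (hμ := hμ) (c := d) ?_)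
  · filter_upwards [hd] with w hw
    exact (le_add_of_nonneg_right (sq_nonneg _)).trans_eq hw
  · filter_upwards [hd] with w hw
    exact (le_add_of_nonneg_left (sq_nonneg _)).trans_eq hw

variable {R : CameronMartin ≃ₗᵢ[ℝ] CameronMartin}
  {P : ℝ → Complexification CameronMartin →L[ℂ] Complexification CameronMartin}
  (hP : IsSpectralResolution (Complexification.mapLinear R.toLinearEquiv.toLinearMap) P)
  {T : WienerSpace → WienerSpace}
include hP

lemma IsTransport.continuous_apply_of_ergodic (hT : IsTransport hμ R.toLinearIsometry T)
    (hE : Ergodic T μ) (z : Complexification CameronMartin) : Continuous fun θ => P θ z :=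
  hP.continuous_apply (Complexification.norm_mapLinear R)
    (fun _ _ hc hv => hT.eq_zero_of_mapLinear_eq_smul hE hc hv) z

lemma IsTransport.isWeakMixing_of_continuousOn (hT : IsTransport hμ R.toLinearIsometry T)
    (hc : ∀ h k : CameronMartin, ContinuousOn (fun θ : ℝ => inner ℂ (Complexification.ofReal k)
      (P θ (Complexification.ofReal h))) (Icc 0 (2 * Real.pi))) : IsWeakMixing T μ := by
  refine hT.isWeakMixing fun h k => ?_
  refine (hP.isNullInMean_inner (Complexification.norm_mapLinear R)
    (fun z => hP.isResolution.nullSingletonClass (Complexification.continuousOn_inner_self hc z))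
    (Complexification.ofReal h) (Complexification.ofReal k)).mono 1 fun n => ?_
  rw [Complexification.mapLinear_pow_ofReal, one_mul, Real.norm_eq_abs, real_inner_comm]
  refine le_trans (le_of_eq ?_) (Complex.abs_re_le_norm _)
  rw [Complexification.re_inner_ofReal]
  rfl

end

end WienerRotation

end

theorem theorem2 (μ : MeasureTheory.Measure WienerRotation.WienerSpace)
    (hμ : WienerRotation.IsWienerMeasure μ)
    (R : WienerRotation.CameronMartin ≃ₗᵢ[ℝ] WienerRotation.CameronMartin)
    (P : ℝ → WienerRotation.Complexification WienerRotation.CameronMartin →L[ℂ]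
      WienerRotation.Complexification WienerRotation.CameronMartin)
    (hP : WienerRotation.IsSpectralResolution
      (WienerRotation.Complexification.mapLinear R.toLinearEquiv.toLinearMap) P)
    (e : HilbertBasis ℕ ℝ WienerRotation.CameronMartin) :
    (∃ T : WienerRotation.WienerSpace → WienerRotation.WienerSpace,
      WienerRotation.IsRotation hμ R e T) ∧
    ∀ T : WienerRotation.WienerSpace → WienerRotation.WienerSpace,
      WienerRotation.IsRotation hμ R e T →
        MeasureTheory.MeasurePreserving T μ μ ∧
        (Ergodic T μ ↔ ∀ h k : WienerRotation.CameronMartin,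
          ContinuousOn (fun θ : ℝ => inner ℂ (WienerRotation.Complexification.ofReal k)
            (P θ (WienerRotation.Complexification.ofReal h))) (Set.Icc 0 (2 * Real.pi))) ∧
        (Ergodic T μ → WienerRotation.IsWeakMixing T μ) := by
  refine ⟨WienerRotation.exists_isRotation hμ R e, fun T hrot => ?_⟩
  have := hμ.isProbabilityMeasure
  have hT := hrot.isTransport
  have hcont : Ergodic T μ → ∀ h k : WienerRotation.CameronMartin,
      ContinuousOn (fun θ : ℝ => inner ℂ (WienerRotation.Complexification.ofReal k)
        (P θ (WienerRotation.Complexification.ofReal h))) (Set.Icc 0 (2 * Real.pi)) :=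
    fun hE _ _ => (continuous_const.inner (hT.continuous_apply_of_ergodic hP hE _)).continuousOn
  exact ⟨hT.measurePreserving, ⟨hcont, fun hc => (hT.isWeakMixing_of_continuousOn hP hc).ergodic⟩,
    fun hE => hT.isWeakMixing_of_continuousOn hP (hcont hE)⟩
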